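/- Let $t,n,p$ be integers with $n\ge 1$ and $3\le p\le t+1$. A crossover design $d$ assigns to each unit $u\in\{1,\dots,n\}$ in each period $k\in\{1,\dots,p\}$ a treatment $d(k,u)\in\{0,1,\dots,t\}$, where $0$ is the control and $1,\dots,t$ are the test treatments. The responses follow the model $$Y_{dku}=\mu+\alpha_k+\beta_u+\tau_{d(k,u)}+\rho_{d(k-1,u)}+e_{ku},\qquad \rho_{d(0,u)}:=0,$$ with independent $N(0,\sigma^2)$ errors, $\sigma^2>0$. Let $\operatorname{Var}_d(\hat\tau_i-\hat\tau_0)$ be the variance of the best linear unbiased estimator of $\tau_i-\tau_0$ ($+\infty$ if $\tau_i-\tau_0$ is not estimable). In a class of designs, a design in which all contrasts $\tau_i-\tau_0$ are estimable is A-optimal if it minimizes $\sum_{i=1}^t\operatorname{Var}_d(\hat\tau_i-\hat\tau_0)$, and MV-optimal if it minimizes $\max_{1\le i\le t}\operatorname{Var}_d(\hat\tau_i-\hat\tau_0)$. Write $n_{diu}$ for the number of times treatment $i$ is assigned to unit $u$, $\tilde n_{diu}$ for the number of times this happens in the first $p-1$ periods, $r_{di}=\sum_u n_{diu}$ and $\tilde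 r_{di}=\sum_u\tilde n_{diu}$. Let $\Lambda_{t+1,n,p}$ be the class of designs in which the control appears $r_{d0}/p$ times in every period and no treatment (test or control) is ever immediately preceded by itself; in it $\tilde r_{d0}=\frac{p-1}{p}r_{d0}$. For $r_{0}>0$ such that $\Lambda_{t+1,n,p}$ contains a design with $r_{d0}=r_0$, let $S_1,S_2,S_3$ be the minima of $\sum_u n_{d0u}^2$, $\sum_u n_{d0u}\tilde n_{d0u}$, $\sum_u\tilde n_{d0u}^2$, each taken separately over the designs $d\in\Lambda_{t+1,n,p}$ with $r_{d0}=r_0$, put $\tilde r_0=\frac{p-1}{p}r_0$ and $$x_1=t(p-1)(np-r_0)-p\Bigl(r_0-\tfrac1pS_1\Bigr)-\frac{\bigl(nt(p-1)-t\tilde r_0-S_2\bigr)^2}{n(p-1)(pt-t-1)-(pt-t+p-2)\tilde r_0+S_3},$$ $$y_1=p\Bigl(r_0-\tfrac1pS_1\Bigr)-\frac{n(p-1)S_2^2}{np(p-1)\tilde r_0-\tilde r_0^2-n(p-1)S_3},\qquad B(r_0)=\frac{t(t-1)^2p}{x_1}+\frac{tp}{y_1}.$$ A design $d$ is a balanced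 test-control block design if (a) all test treatments have the same replication; (b) each test treatment appears at most once in each unit; (c) the number of units containing both $i$ and $j$ is the same for all pairs of test treatments $i\ne j$; (d) the control appears $\lfloor r_{d0}/n\rfloor$ or $\lfloor r_{d0}/n\rfloor+1$ times in each unit; (e) the number of units in which the control appears $\lfloor r_{d0}/n\rfloor$ times and test treatment $i$ appears is the same for all test treatments $i$. A design $d$ is a totally balanced test-control incomplete crossover design if: 1. $d$ is a balanced test-control block design; 2. so is the design formed by its first $p-1$ periods; 3. the number of times that $i$ is immediately preceded by $j$ is the same for all pairs of test treatments $i\neq j$, the number of times that the control is immediately preceded by $i$ is the same for all test treatments $i$, the number of times that $i$ is immediately preceded by the control is the same for all test treatments $i$, and no treatment is immediately preceded by itself; 4. in every period each test treatment appears exactly $\frac{np-r_{d0}}{tp}$ times and the control exactly $\frac{r_{d0}}p$ times; 5. the number of units in which $j$ appears once in the first $p-1$ periods and $i$ appears once (in all $p$ periods) is the same for all pairs of test treatments $i\ne j$; the number of units in which the control appears $\lfloor\tilde r_{d0}/n\rfloor$ times in the first $p-1$ periods and $i$ appears once is the same for all test treatments $i$; the number of units in which $i$ appears once in the first $p-1$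 periods and the control appears $\lfloor r_{d0}/n\rfloor$ times is the same for all test treatments $i$. **Theorem.** Let $d^*$ be a totally balanced test-control incomplete crossover design such that $r_{d^*0}>0$ and $B(r_{d^*0})\le B(r_0)$ for every $r_0>0$ that is the control replication of some design in $\Lambda_{t+1,n,p}$. Then $d^*$ is simultaneously A-optimal and MV-optimal in $\Lambda_{t+1,n,p}$. -/

import Mathlib

open MeasureTheory ProbabilityTheory
open scoped NNReal ENNReal

namespace Crossover

noncomputable section

/-- A crossover design with `p` periods, `n` units and `t` test treatments: `d k u` is the treatment
given to unit `u` in period `k`.  Treatment `0` is the control, the test treatments are `i.succ`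
for `i : Fin t`. -/
abbrev Design (p n t : ℕ) : Type := Fin p → Fin n → Fin (t + 1)

variable {p n t : ℕ}

/-- The design formed by the first `p - 1` periods. -/
def initPeriods (d : Design p n t) : Design (p - 1) n t :=
  fun k u => d (Fin.castLE (Nat.sub_le p 1) k) u

/-- The treatment given to unit `u` in the period just before `k` (none in the first period). -/
def preceding (d : Design p n t) (k : Fin p) (u : Fin n) : Option (Fin (t + 1)) :=
  if (k : ℕ) = 0 then none
  else some (d ⟨(k : ℕ) - 1, lt_of_le_of_lt (Nat.sub_le _ _) k.isLt⟩ u)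

/-! ### Counts -/

/-- Number of times treatment `i` is given to unit `u`. -/
def unitCount (d : Design p n t) (i : Fin (t + 1)) (u : Fin n) : ℕ :=
  (Finset.univ.filter fun k : Fin p => d k u = i).card

/-- Number of times treatment `i` is given to unit `u` in the first `p - 1` periods. -/
def unitCountInit (d : Design p n t) (i : Fin (t + 1)) (u : Fin n) : ℕ :=
  unitCount (initPeriods d) i u

/-- Number of times treatment `i` is used in period `k`. -/
def periodCount (d : Design p n t) (i : Fin (t + 1)) (k : Fin p) : ℕ :=
  (Finset.univ.filter fun u : Fin n => d k u = i).card

/-- Number of times treatment `i` is immediately preceded by treatment `j`. -/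
def precededCount (d : Design p n t) (i j : Fin (t + 1)) : ℕ :=
  (Finset.univ.filter fun q : Fin p × Fin n =>
    d q.1 q.2 = i ∧ preceding d q.1 q.2 = some j).card

/-- Total replication of treatment `i`. -/
def replication (d : Design p n t) (i : Fin (t + 1)) : ℕ :=
  (Finset.univ.filter fun q : Fin p × Fin n => d q.1 q.2 = i).card

/-- Total replication of treatment `i` in the first `p - 1` periods. -/
def replicationInit (d : Design p n t) (i : Fin (t + 1)) : ℕ :=
  replication (initPeriods d) i

/-! ### The response model and the variances of the estimated contrasts -/

/-- The parameters of the response model. -/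
structure Params (p n t : ℕ) where
  /-- general mean -/
  mean : ℝ
  /-- period effects -/
  period : Fin p → ℝ
  /-- unit effects -/
  unit : Fin n → ℝ
  /-- direct treatment effects -/
  direct : Fin (t + 1) → ℝ
  /-- carryover treatment effects -/
  carryover : Fin (t + 1) → ℝ

/-- Expected response of unit `u` in period `k`; there is no carryover in the first period. -/
def expectedResponse (d : Design p n t) (θ : Params p n t) (k : Fin p) (u : Fin n) : ℝ :=
  θ.mean + θ.period k + θ.unit u + θ.direct (d k u) + (preceding d k u).elim 0 θ.carryover

/-- The response of unit `u` in period `k`, for the error vector `e`. -/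
def response (d : Design p n t) (θ : Params p n t) (e : Fin p × Fin n → ℝ)
    (k : Fin p) (u : Fin n) : ℝ :=
  expectedResponse d θ k u + e (k, u)

/-- Law of the errors: independent, normal, mean `0`, variance `v`. -/
def errorLaw (p n : ℕ) (v : ℝ≥0) : Measure (Fin p × Fin n → ℝ) :=
  Measure.pi fun _ => gaussianReal 0 v

/-- The linear estimator with coefficients `a`. -/
def linearEstimator (d : Design p n t) (a : Fin p → Fin n → ℝ) (θ : Params p n t)
    (e : Fin p × Fin n → ℝ) : ℝ :=
  ∑ k, ∑ u, a k u * response d θ e k u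

/-- The linear estimator with coefficients `a` is unbiased for the contrast
(direct effect of test treatment `i`) - (direct effect of the control). -/
def IsUnbiased (d : Design p n t) (v : ℝ≥0) (i : Fin t) (a : Fin p → Fin n → ℝ) : Prop :=
  ∀ θ : Params p n t,
    ∫ e, linearEstimator d a θ e ∂(errorLaw p n v) = θ.direct i.succ - θ.direct 0

/-- Variance of the best linear unbiased estimator of the contrast between test treatment `i` and
the control: the least variance of a linear unbiased estimator, and `⊤` if the contrast is not
estimable.  The variance of a linear estimator does not depend on the parameters, so that it is
computed at the zero parameter. -/
def contrastVar (d : Design p n t) (v : ℝ≥0) (i : Fin t) : ℝ≥0∞ :=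
  ⨅ (a : Fin p → Fin n → ℝ) (_ : IsUnbiased d v i a),
    evariance (linearEstimator d a ⟨0, 0, 0, 0, 0⟩) (errorLaw p n v)

/-- `d` is A-optimal in the class `D`: all contrasts with the control are estimable in `d`, and the
sum of the variances of their estimators is least in `D`. -/
def IsAOptimal (v : ℝ≥0) (D : Set (Design p n t)) (d : Design p n t) : Prop :=
  d ∈ D ∧ (∑ i, contrastVar d v i) < ⊤ ∧
    ∀ d' ∈ D, (∑ i, contrastVar d v i) ≤ ∑ i, contrastVar d' v i

/-- `d` is MV-optimal in the class `D`: all contrasts with the control are estimable in `d`, and the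
largest variance of their estimators is least in `D`. -/
def IsMVOptimal (v : ℝ≥0) (D : Set (Design p n t)) (d : Design p n t) : Prop :=
  d ∈ D ∧ (⨆ i, contrastVar d v i) < ⊤ ∧
    ∀ d' ∈ D, (⨆ i, contrastVar d v i) ≤ ⨆ i, contrastVar d' v i

/-! ### The class of competing designs and the lower bound -/

/-- The class of designs in which the control appears equally often in all periods and no treatment
is immediately preceded by itself. -/
def Lam (t n p : ℕ) : Set (Design p n t) :=
  {d | (∀ k, (periodCount d 0 k : ℝ) = (replication d 0 : ℝ) / p) ∧
    ∀ i, precededCount d i i = 0}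

/-- Least value of `f` over the designs of the class with control replication `r`. -/
def minOver (t n p r : ℕ) (f : Design p n t → ℕ) : ℕ :=
  sInf {s | ∃ d ∈ Lam t n p, replication d 0 = r ∧ f d = s}

/-- Least sum of squares of the control counts per unit. -/
def minSq (t n p r : ℕ) : ℕ :=
  minOver t n p r fun d => ∑ u, unitCount d 0 u ^ 2

/-- Least sum of products of the control counts per unit in all and in the first `p - 1` periods. -/
def minCross (t n p r : ℕ) : ℕ :=
  minOver t n p r fun d => ∑ u, unitCount d 0 u * unitCountInit d 0 u

/-- Least sum of squares of the control counts per unit in the first `p - 1` periods. -/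
def minSqInit (t n p r : ℕ) : ℕ :=
  minOver t n p r fun d => ∑ u, unitCountInit d 0 u ^ 2

/-- Control replication in the first `p - 1` periods of a design of the class with control
replication `r`. -/
def rInit (p r : ℕ) : ℝ := ((p : ℝ) - 1) * r / p

def x₁ (t n p r : ℕ) : ℝ :=
  (t : ℝ) * (p - 1) * (n * p - r) - p * (r - 1 / p * minSq t n p r)
    - ((n : ℝ) * t * (p - 1) - t * rInit p r - minCross t n p r) ^ 2 /
      ((n : ℝ) * (p - 1) * (p * t - t - 1) - (p * t - t + p - 2) * rInit p r + minSqInit t n p r)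

def y₁ (t n p r : ℕ) : ℝ :=
  (p : ℝ) * (r - 1 / p * minSq t n p r)
    - (n : ℝ) * (p - 1) * (minCross t n p r : ℝ) ^ 2 /
      ((n : ℝ) * p * (p - 1) * rInit p r - rInit p r ^ 2 - (n : ℝ) * (p - 1) * minSqInit t n p r)

/-- The lower bound for the sum of the (standardized) variances, as a function of the control
replication `r`. -/
def lowerBound (t n p r : ℕ) : ℝ :=
  (t : ℝ) * (t - 1) ^ 2 * p / x₁ t n p r + (t : ℝ) * p / y₁ t n p r

/-- The control replications that are possible in the class and positive (with replication `0` no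
contrast with the control is estimable). -/
def admissible (t n p : ℕ) : Set ℕ :=
  {r | 0 < r ∧ ∃ d ∈ Lam t n p, replication d 0 = r}

/-! ### Totally balanced test-control incomplete crossover designs -/

/-- Balanced test-control incomplete block design for the direct effects (units as blocks). -/
structure IsBalancedBlock (d : Design p n t) : Prop where
  rep_eq : ∀ i j : Fin t, replication d i.succ = replication d j.succ
  binary : ∀ (i : Fin t) (u : Fin n), unitCount d i.succ u ≤ 1
  pair : ∃ c : ℕ, ∀ i j : Fin t, i ≠ j →
    (Finset.univ.filter fun u =>
      1 ≤ unitCount d i.succ u ∧ 1 ≤ unitCount d j.succ u).card = c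
  control : ∀ u, unitCount d 0 u = replication d 0 / n ∨
    unitCount d 0 u = replication d 0 / n + 1
  control_pair : ∃ c : ℕ, ∀ i : Fin t,
    (Finset.univ.filter fun u =>
      unitCount d 0 u = replication d 0 / n ∧ 1 ≤ unitCount d i.succ u).card = c

/-- Balanced test-control incomplete block design for the carryover effects. -/
def IsBalancedBlockCarryover (d : Design p n t) : Prop :=
  IsBalancedBlock (initPeriods d)

/-- Balanced for test-control carryover effects. -/
structure IsCarryoverBalanced (d : Design p n t) : Prop where
  test_test : ∃ c : ℕ, ∀ i j : Fin t, i ≠ j → precededCount d i.succ j.succ = c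
  control_test : ∃ c : ℕ, ∀ i : Fin t, precededCount d 0 i.succ = c
  test_control : ∃ c : ℕ, ∀ i : Fin t, precededCount d i.succ 0 = c
  no_self : ∀ i, precededCount d i i = 0

/-- Proportional frequency design for test-control on the periods. -/
structure IsProportional (d : Design p n t) : Prop where
  test : ∀ (i : Fin t) (k : Fin p),
    (periodCount d i.succ k : ℝ) = ((n : ℝ) * p - replication d 0) / (t * p)
  control : ∀ k : Fin p, (periodCount d 0 k : ℝ) = (replication d 0 : ℝ) / p

/-- Totally balanced test-control incomplete crossover design. -/
structure IsTotallyBalanced (d : Design p n t) : Prop where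
  block : IsBalancedBlock d
  block_carryover : IsBalancedBlockCarryover d
  carryover : IsCarryoverBalanced d
  proportional : IsProportional d
  mixed_test : ∃ c : ℕ, ∀ i j : Fin t, i ≠ j →
    (Finset.univ.filter fun u =>
      unitCountInit d j.succ u = 1 ∧ unitCount d i.succ u = 1).card = c
  mixed_control_init : ∃ c : ℕ, ∀ i : Fin t,
    (Finset.univ.filter fun u =>
      unitCountInit d 0 u = replicationInit d 0 / n ∧ unitCount d i.succ u = 1).card = c
  mixed_control : ∃ c : ℕ, ∀ i : Fin t,
    (Finset.univ.filter fun u =>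
      unitCountInit d i.succ u = 1 ∧ unitCount d 0 u = replication d 0 / n).card = c

end

end Crossover

namespace Crossover

noncomputable section

variable {p n t : ℕ}

/-! ### Moments of linear estimators -/

/-! Put p = m + 1, let c be the number of control units per period, and let T_j, F_j be the
incidence vectors of the direct and carryover effects of treatment j. The proof is a duality
argument with explicit trial weights.

If the weights `a` are unbiased for a contrast, then |a|² ≥ 2⟨a,w⟩ - |w|² for every w; when w is a
doubly centered vector of effects, ⟨a,w⟩ is the contrast of those effects, so the bound no longer
involves `a` (`le_contrastVar`). When w solves the normal equations, it is itself an unbiased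
estimator and its variance is read off its effects (`contrastVar_le`).

The trial weights for test treatment i are the centering of A(T_i + lF_i + (T_0 + lF_0)/t) - B(T_0 +
sF_0). Here l and s are the regression coefficients on carryover built from the minima S₁, S₂, S₃,
and A, B maximize the resulting bound. Summed over i, only two quantities remain. One is a test
part, bounded in terms of c and the control counts (`sum_center_mixInc_le`, `center_mixInc_zero`);
the other is a control part, computed exactly. If the control counts of a design exceed the minima
by Δ₁, Δ₂, Δ₃ ≥ 0, the test part may grow by Δ₁ + 2lΔ₂ + l²Δ₃ while the control part shrinks by Δ₁ +
2sΔ₂ + s²Δ₃. The net change helps the bound once (t-1)y₁ ≤ x₁ and (t-1)y₁l ≤ x₁s (`weights_bound`).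
These two inequalities, `control_le_test` and `control_le_test_weighted`, are the analytic core;
they use m ≤ t and the fact that the control fills at most half of each period. Hence B(r₀) bounds
the standardized sum of variances (`le_sum_contrastVar`).

A totally balanced design attains the three minima simultaneously, and its centered Gram matrices
are completely symmetric on the test treatments. The same weights therefore solve its normal
equations, and each contrast has standardized variance at most B/t
(`contrastVar_le_of_isTotallyBalanced`). Summation gives A-optimality, and "maximum ≥ average" gives
MV-optimality. -/

theorem integrable_eval_errorLaw (v : ℝ≥0) (q : Fin p × Fin n) :
    Integrable (fun e : Fin p × Fin n → ℝ => e q) (errorLaw p n v) := by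
  have h : Integrable id (gaussianReal 0 v) :=
    (memLp_id_gaussianReal (μ := 0) (v := v) 1).integrable (by simp)
  exact (measurePreserving_eval (fun _ : Fin p × Fin n => gaussianReal 0 v) q).integrable_comp_of_integrable h

theorem integral_eval_errorLaw (v : ℝ≥0) (q : Fin p × Fin n) :
    ∫ e, e q ∂(errorLaw p n v) = 0 := by
  have h := (measurePreserving_eval (fun _ : Fin p × Fin n => gaussianReal 0 v) q)
  have h2 := integral_map (μ := errorLaw p n v) (φ := Function.eval q) (f := fun x : ℝ => x)
    h.measurable.aemeasurable (by fun_prop)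
  have h3 : Measure.map (Function.eval q) (errorLaw p n v) = gaussianReal 0 v := h.map_eq
  rw [h3, integral_id_gaussianReal] at h2
  exact h2.symm

theorem integral_linearEstimator (d : Design p n t) (v : ℝ≥0) (a : Fin p → Fin n → ℝ)
    (θ : Params p n t) :
    ∫ e, linearEstimator d a θ e ∂(errorLaw p n v) =
      ∑ k, ∑ u, a k u * expectedResponse d θ k u := by
  have : IsProbabilityMeasure (errorLaw p n v) := by unfold errorLaw; infer_instance
  unfold linearEstimator response
  have hi : ∀ k u, Integrable (fun e : Fin p × Fin n → ℝ =>
      a k u * (expectedResponse d θ k u + e (k, u))) (errorLaw p n v) := fun k u =>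
    ((integrable_const _).add (integrable_eval_errorLaw v (k, u))).const_mul _
  rw [integral_finsetSum _ fun k _ => integrable_finsetSum _ fun u _ => hi k u]
  refine Finset.sum_congr rfl fun k _ => ?_
  rw [integral_finsetSum _ fun u _ => hi k u]
  refine Finset.sum_congr rfl fun u _ => ?_
  rw [integral_const_mul, integral_add (integrable_const _) (integrable_eval_errorLaw v (k, u)),
    integral_eval_errorLaw]
  simp

theorem evariance_linearEstimator (d : Design p n t) (v : ℝ≥0) (a : Fin p → Fin n → ℝ) :
    evariance (linearEstimator d a ⟨0, 0, 0, 0, 0⟩) (errorLaw p n v) =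
      ENNReal.ofReal (v * ∑ k, ∑ u, a k u ^ 2) := by
  have : IsProbabilityMeasure (errorLaw p n v) := by unfold errorLaw; infer_instance
  have hx : ∀ q : Fin p × Fin n,
      MemLp (fun x : ℝ => a q.1 q.2 * x) 2 (gaussianReal 0 v) := fun q =>
    (memLp_id_gaussianReal (μ := 0) (v := v) 2).const_mul _
  have he : linearEstimator d a ⟨0, 0, 0, 0, 0⟩ =
      ∑ q : Fin p × Fin n, fun e : Fin p × Fin n → ℝ => a q.1 q.2 * e q := by
    funext e
    simp only [linearEstimator, response, expectedResponse, Finset.sum_apply,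
      Fintype.sum_prod_type]
    refine Finset.sum_congr rfl fun k _ => Finset.sum_congr rfl fun u _ => ?_
    cases preceding d k u <;> simp
  have hm : MemLp (linearEstimator d a ⟨0, 0, 0, 0, 0⟩) 2 (errorLaw p n v) := by
    rw [he]
    refine memLp_finsetSum' _ fun q _ => ?_
    exact (hx q).comp_measurePreserving
      (measurePreserving_eval (fun _ : Fin p × Fin n => gaussianReal 0 v) q)
  rw [← hm.ofReal_variance_eq, he]
  unfold errorLaw
  rw [variance_sum_pi (μ := fun _ : Fin p × Fin n => gaussianReal 0 v)
    (X := fun q x => a q.1 q.2 * x) hx]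
  congr 1
  rw [Finset.mul_sum, Fintype.sum_prod_type]
  refine Finset.sum_congr rfl fun k _ => ?_
  rw [Finset.mul_sum]
  refine Finset.sum_congr rfl fun u _ => ?_
  have := variance_id_gaussianReal (μ := 0) (v := v)
  rw [variance_const_mul]
  change _ * Var[id; gaussianReal 0 v] = _
  rw [this, mul_comm]

/-! ### Projection orthogonal to the period and unit effects -/

/-- Double centering: the projection orthogonal to the period and unit effects. -/
def center (p n : ℕ) : (Fin p × Fin n → ℝ) →ₗ[ℝ] (Fin p × Fin n → ℝ) where
  toFun z q := z q - (∑ k, z (k, q.2)) / p - (∑ u, z (q.1, u)) / n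
    + (∑ k, ∑ u, z (k, u)) / (p * n)
  map_add' x y := by
    funext q
    simp only [Pi.add_apply, Finset.sum_add_distrib]
    ring
  map_smul' c x := by
    funext q
    simp only [Pi.smul_apply, smul_eq_mul, ← Finset.mul_sum, RingHom.id_apply]
    ring

theorem center_apply (z : Fin p × Fin n → ℝ) (q : Fin p × Fin n) :
    center p n z q = z q - (∑ k, z (k, q.2)) / p - (∑ u, z (q.1, u)) / n
      + (∑ k, ∑ u, z (k, u)) / (p * n) := rfl

theorem center_dotProduct (z w : Fin p × Fin n → ℝ) :
    center p n z ⬝ᵥ w = z ⬝ᵥ w - (∑ u, (∑ k, z (k, u)) * ∑ k, w (k, u)) / p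
      - (∑ k, (∑ u, z (k, u)) * ∑ u, w (k, u)) / n
      + (∑ k, ∑ u, z (k, u)) * (∑ k, ∑ u, w (k, u)) / (p * n) := by
  have h1 : ∑ k, ∑ u, (∑ k', z (k', u)) / p * w (k, u) =
      (∑ u, (∑ k, z (k, u)) * ∑ k, w (k, u)) / p := by
    rw [Finset.sum_comm, Finset.sum_div]
    refine Finset.sum_congr rfl fun u _ => ?_
    rw [← Finset.mul_sum]; ring
  have h2 : ∑ k, ∑ u, (∑ u', z (k, u')) / n * w (k, u) =
      (∑ k, (∑ u, z (k, u)) * ∑ u, w (k, u)) / n := by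
    rw [Finset.sum_div]
    refine Finset.sum_congr rfl fun u _ => ?_
    rw [← Finset.mul_sum]; ring
  simp only [dotProduct, center_apply, Fintype.sum_prod_type, add_mul, sub_mul,
    Finset.sum_add_distrib, Finset.sum_sub_distrib, h1, h2]
  simp only [← Finset.mul_sum]
  ring

theorem center_dotProduct_comm (z w : Fin p × Fin n → ℝ) :
    center p n z ⬝ᵥ w = center p n w ⬝ᵥ z := by
  rw [center_dotProduct, center_dotProduct, dotProduct_comm]
  simp only [mul_comm]

theorem sum_periods_center (hp : p ≠ 0) (z : Fin p × Fin n → ℝ) (u : Fin n) :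
    ∑ k, center p n z (k, u) = 0 := by
  have hp' : (p : ℝ) ≠ 0 := by exact_mod_cast hp
  simp only [center_apply, Finset.sum_add_distrib, Finset.sum_sub_distrib, Finset.sum_const,
    Finset.card_univ, Fintype.card_fin, nsmul_eq_mul, ← Finset.sum_div]
  field_simp
  ring

theorem sum_units_center (hn : n ≠ 0) (z : Fin p × Fin n → ℝ) (k : Fin p) :
    ∑ u, center p n z (k, u) = 0 := by
  have hp' : (n : ℝ) ≠ 0 := by exact_mod_cast hn
  simp only [center_apply, Finset.sum_add_distrib, Finset.sum_sub_distrib, Finset.sum_const,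
    Finset.card_univ, Fintype.card_fin, nsmul_eq_mul, ← Finset.sum_div]
  rw [Finset.sum_comm]
  field_simp
  ring

theorem center_dotProduct_center (hp : p ≠ 0) (hn : n ≠ 0) (z w : Fin p × Fin n → ℝ) :
    center p n z ⬝ᵥ center p n w = center p n z ⬝ᵥ w := by
  rw [dotProduct_comm, center_dotProduct, dotProduct_comm]
  simp [sum_periods_center hp, sum_units_center hn]

/-- The double centering kills additive arrays. -/
theorem center_additive (hp : p ≠ 0) (hn : n ≠ 0) (α : Fin p → ℝ) (β : Fin n → ℝ) :
    center p n (fun q => α q.1 + β q.2) = 0 := by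
  have hp' : (p : ℝ) ≠ 0 := by exact_mod_cast hp
  have hn' : (n : ℝ) ≠ 0 := by exact_mod_cast hn
  funext q
  simp only [center_apply, Finset.sum_add_distrib, Finset.sum_const,
    Finset.card_univ, Fintype.card_fin, nsmul_eq_mul, Pi.zero_apply, ← Finset.mul_sum]
  field_simp
  ring

/-! ### Incidence vectors -/

/-- Incidence vector of the direct effect of treatment `j`. -/
def directInc (d : Design p n t) (j : Fin (t + 1)) : Fin p × Fin n → ℝ :=
  fun q => if d q.1 q.2 = j then 1 else 0

/-- Incidence vector of the carryover effect of treatment `j`. -/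
def carryInc (d : Design p n t) (j : Fin (t + 1)) : Fin p × Fin n → ℝ :=
  fun q => if preceding d q.1 q.2 = some j then 1 else 0

/-- Expected responses for direct effects `δ` and carryover effects `γ`. -/
def effect (d : Design p n t) (δ γ : Fin (t + 1) → ℝ) : Fin p × Fin n → ℝ :=
  ∑ j, (δ j • directInc d j + γ j • carryInc d j)

theorem effect_apply (d : Design p n t) (δ γ : Fin (t + 1) → ℝ) (k : Fin p) (u : Fin n) :
    effect d δ γ (k, u) = δ (d k u) + (preceding d k u).elim 0 γ := by
  simp only [effect, directInc, carryInc, Finset.sum_apply, Pi.add_apply, Pi.smul_apply,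
    smul_eq_mul, mul_ite, mul_one, mul_zero, Finset.sum_add_distrib, Finset.sum_ite_eq,
    Finset.mem_univ, if_true]
  cases preceding d k u <;> simp

/-- The centered vector of effects is a vector of expected responses. -/
theorem exists_params (d : Design p n t) (δ γ : Fin (t + 1) → ℝ) :
    ∃ θ : Params p n t, θ.direct = δ ∧
      ∀ k u, expectedResponse d θ k u = center p n (effect d δ γ) (k, u) := by
  let z := effect d δ γ
  -- The centering corrections are absorbed by the mean, period and unit effects, so they leave the
  -- treatment effects untouched.
  refine ⟨⟨(∑ k, ∑ u, z (k, u)) / (p * n), fun k => -(∑ u, z (k, u)) / n,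
    fun u => -(∑ k, z (k, u)) / p, δ, γ⟩, rfl, fun k u => ?_⟩
  rw [center_apply, effect_apply]
  simp only [expectedResponse, z]
  ring

theorem isUnbiased_iff (d : Design p n t) (v : ℝ≥0) (i : Fin t) (a : Fin p → Fin n → ℝ) :
    IsUnbiased d v i a ↔ ∀ θ : Params p n t,
      ∑ k, ∑ u, a k u * expectedResponse d θ k u = θ.direct i.succ - θ.direct 0 := by
  simp only [IsUnbiased, integral_linearEstimator]

/-- Lower bound for the variance of a contrast. -/
theorem le_contrastVar (d : Design p n t) (v : ℝ≥0) (i : Fin t) (δ γ : Fin (t + 1) → ℝ) :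
    ENNReal.ofReal (v * (2 * (δ i.succ - δ 0) -
      center p n (effect d δ γ) ⬝ᵥ center p n (effect d δ γ))) ≤ contrastVar d v i := by
  refine le_iInf₂ fun a ha => ?_
  rw [evariance_linearEstimator]
  refine ENNReal.ofReal_le_ofReal (mul_le_mul_of_nonneg_left ?_ v.2)
  obtain ⟨θ, hθ, h⟩ := exists_params d δ γ
  have h1 := (isUnbiased_iff d v i a).1 ha θ
  rw [hθ] at h1
  simp only [h] at h1
  rw [← h1, dotProduct, Fintype.sum_prod_type, Finset.mul_sum, ← Finset.sum_sub_distrib]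
  refine Finset.sum_le_sum fun k _ => ?_
  rw [Finset.mul_sum, ← Finset.sum_sub_distrib]
  refine Finset.sum_le_sum fun u _ => ?_
  -- Pointwise form of 2⟨a,w⟩ - |w|² ≤ |a|².
  nlinarith [sq_nonneg (a k u - center p n (effect d δ γ) (k, u))]

/-- Without control replication no contrast with the control is estimable. -/
theorem contrastVar_eq_top (d : Design p n t) (v : ℝ≥0) (i : Fin t)
    (h0 : ∀ k u, d k u ≠ 0) : contrastVar d v i = ⊤ := by
  refine iInf₂_eq_top.2 fun a ha => ?_
  -- A direct effect of the control alone is invisible in the responses, yet it changes the contrast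
  -- by -1.
  have h := (isUnbiased_iff d v i a).1 ha ⟨0, 0, 0, fun j => if j = 0 then 1 else 0, 0⟩
  exfalso
  simp only [expectedResponse, h0] at h
  have : ∀ k u, (preceding d k u).elim (0 : ℝ) 0 = 0 := fun k u => by
    cases preceding d k u <;> rfl
  simp [this] at h

/-- Upper bound for the variance of a contrast, by an estimator in the centered space. -/
theorem contrastVar_le (hp : p ≠ 0) (hn : n ≠ 0) (d : Design p n t) (v : ℝ≥0) (i : Fin t)
    (δ γ : Fin (t + 1) → ℝ)
    (hT : ∀ j, center p n (effect d δ γ) ⬝ᵥ directInc d j =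
      (if j = i.succ then 1 else 0) - (if j = 0 then 1 else 0))
    (hF : ∀ j, center p n (effect d δ γ) ⬝ᵥ carryInc d j = 0) :
    contrastVar d v i ≤ ENNReal.ofReal (v * (δ i.succ - δ 0)) := by
  -- The normal equations say that pairing with the centered vector evaluates the contrast. Used at
  -- arbitrary effects this is unbiasedness; used at `δ`, `γ` themselves it gives the squared length
  -- of the weights.
  have key : ∀ δ' γ' : Fin (t + 1) → ℝ,
      center p n (effect d δ γ) ⬝ᵥ effect d δ' γ' = δ' i.succ - δ' 0 := fun δ' γ' => by
    simp only [effect, dotProduct_sum, dotProduct_add, dotProduct_smul] at hT hF ⊢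
    simp only [hT, hF, smul_eq_mul, mul_sub, mul_ite, mul_one, mul_zero, add_zero,
      Finset.sum_sub_distrib, Finset.sum_ite_eq', Finset.mem_univ, if_true]
  have hunb : IsUnbiased d v i fun k u => center p n (effect d δ γ) (k, u) := by
    rw [isUnbiased_iff]
    intro θ
    have h1 : (∑ k, ∑ u, center p n (effect d δ γ) (k, u) * expectedResponse d θ k u) =
        center p n (effect d δ γ) ⬝ᵥ
          ((fun q => (θ.mean + θ.period q.1) + θ.unit q.2) + effect d θ.direct θ.carryover) := by
      rw [dotProduct, Fintype.sum_prod_type]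
      refine Finset.sum_congr rfl fun k _ => Finset.sum_congr rfl fun u _ => ?_
      rw [Pi.add_apply, effect_apply, expectedResponse]
      ring
    rw [h1, dotProduct_add, key, center_dotProduct_comm,
      center_additive hp hn (fun k => θ.mean + θ.period k) θ.unit]
    simp
  refine (iInf₂_le _ hunb).trans ?_
  rw [evariance_linearEstimator, ← key δ γ, ← center_dotProduct_center hp hn, dotProduct,
    Fintype.sum_prod_type]
  simp only [sq]
  rfl

end

end Crossover

namespace Crossover

noncomputable section

variable {m n t : ℕ}

/-! ### Counts as sums -/

@[simp] theorem preceding_zero (d : Design (m + 1) n t) (u : Fin n) :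
    preceding d 0 u = none := by
  simp [preceding]

@[simp] theorem preceding_succ (d : Design (m + 1) n t) (k : Fin m) (u : Fin n) :
    preceding d k.succ u = some (d k.castSucc u) := by
  simp only [preceding, Fin.val_succ, Nat.add_eq_zero_iff, one_ne_zero, and_false, if_false,
    Nat.add_sub_cancel]
  rfl

theorem unitCount_eq_sum {p : ℕ} (d : Design p n t) (j : Fin (t + 1)) (u : Fin n) :
    unitCount d j u = ∑ k, if d k u = j then 1 else 0 := by
  rw [unitCount, Finset.card_filter]

theorem unitCountInit_eq_sum (d : Design (m + 1) n t) (j : Fin (t + 1)) (u : Fin n) :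
    unitCountInit d j u = ∑ k : Fin m, if d k.castSucc u = j then 1 else 0 :=
  unitCount_eq_sum (initPeriods d) j u

theorem replication_eq_sum {p : ℕ} (d : Design p n t) (j : Fin (t + 1)) :
    replication d j = ∑ k, ∑ u, if d k u = j then 1 else 0 := by
  rw [replication, Finset.card_filter, Fintype.sum_prod_type]

theorem replicationInit_eq_sum (d : Design (m + 1) n t) (j : Fin (t + 1)) :
    replicationInit d j = ∑ k : Fin m, ∑ u, if d k.castSucc u = j then 1 else 0 :=
  replication_eq_sum (initPeriods d) j

theorem periodCount_eq_sum {p : ℕ} (d : Design p n t) (j : Fin (t + 1)) (k : Fin p) :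
    periodCount d j k = ∑ u, if d k u = j then 1 else 0 := by
  rw [periodCount, Finset.card_filter]

theorem precededCount_eq_sum (d : Design (m + 1) n t) (i j : Fin (t + 1)) :
    precededCount d i j =
      ∑ k : Fin m, ∑ u, if d k.succ u = i ∧ d k.castSucc u = j then 1 else 0 := by
  rw [precededCount, Finset.card_filter, Fintype.sum_prod_type, Fin.sum_univ_succ]
  simp [-Finset.sum_boole]

theorem sum_unitCount {p : ℕ} (d : Design p n t) (j : Fin (t + 1)) :
    ∑ u, unitCount d j u = replication d j := by
  simp only [unitCount_eq_sum, replication_eq_sum]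
  exact Finset.sum_comm

theorem sum_unitCountInit (d : Design (m + 1) n t) (j : Fin (t + 1)) :
    ∑ u, unitCountInit d j u = replicationInit d j :=
  sum_unitCount (initPeriods d) j

theorem sum_periodCount {p : ℕ} (d : Design p n t) (j : Fin (t + 1)) :
    ∑ k, periodCount d j k = replication d j := by
  simp only [periodCount_eq_sum, replication_eq_sum]

theorem sum_periodCount_castSucc (d : Design (m + 1) n t) (j : Fin (t + 1)) :
    ∑ k : Fin m, periodCount d j k.castSucc = replicationInit d j := by
  simp only [periodCount_eq_sum, replicationInit_eq_sum]

theorem unitCount_eq_add_last (d : Design (m + 1) n t) (j : Fin (t + 1)) (u : Fin n) :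
    unitCount d j u = unitCountInit d j u + if d (Fin.last m) u = j then 1 else 0 := by
  rw [unitCount_eq_sum, unitCountInit_eq_sum, Fin.sum_univ_castSucc]

theorem unitCountInit_le (d : Design (m + 1) n t) (j : Fin (t + 1)) (u : Fin n) :
    unitCountInit d j u ≤ unitCount d j u := by
  rw [unitCount_eq_add_last]; exact Nat.le_add_right _ _

theorem unitCountInit_le_periods (d : Design (m + 1) n t) (j : Fin (t + 1)) (u : Fin n) :
    unitCountInit d j u ≤ m := by
  unfold unitCountInit unitCount
  exact (Finset.card_le_univ _).trans (by simp)

theorem sum_replication {p : ℕ} (d : Design p n t) :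
    replication d 0 + ∑ i : Fin t, replication d i.succ = n * p := by
  rw [← Fin.sum_univ_succ (f := fun j => replication d j)]
  simp only [replication_eq_sum]
  rw [Finset.sum_comm]
  have : ∀ k : Fin p, ∑ j, ∑ u, (if d k u = j then 1 else 0) = n := fun k => by
    rw [Finset.sum_comm]; simp
  rw [Finset.sum_congr rfl fun k _ => this k]
  simp [mul_comm]

theorem sum_replicationInit (d : Design (m + 1) n t) :
    replicationInit d 0 + ∑ i : Fin t, replicationInit d i.succ = n * m :=
  sum_replication (initPeriods d)

theorem sum_periodCount_treatments {p : ℕ} (d : Design p n t) (k : Fin p) :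
    periodCount d 0 k + ∑ i : Fin t, periodCount d i.succ k = n := by
  rw [← Fin.sum_univ_succ (f := fun j => periodCount d j k)]
  simp only [periodCount_eq_sum]
  rw [Finset.sum_comm]
  simp

/-! ### Sums of incidence vectors -/

theorem sum_periods_directInc {p : ℕ} (d : Design p n t) (j : Fin (t + 1)) (u : Fin n) :
    ∑ k, directInc d j (k, u) = unitCount d j u := by
  simp [directInc, unitCount_eq_sum]

theorem sum_units_directInc {p : ℕ} (d : Design p n t) (j : Fin (t + 1)) (k : Fin p) :
    ∑ u, directInc d j (k, u) = periodCount d j k := by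
  simp [directInc, periodCount_eq_sum]

theorem sum_periods_carryInc (d : Design (m + 1) n t) (j : Fin (t + 1)) (u : Fin n) :
    ∑ k, carryInc d j (k, u) = unitCountInit d j u := by
  rw [Fin.sum_univ_succ]
  simp [carryInc, unitCountInit_eq_sum]

theorem sum_units_carryInc_zero (d : Design (m + 1) n t) (j : Fin (t + 1)) :
    ∑ u, carryInc d j (0, u) = 0 := by
  simp [carryInc]

theorem sum_units_carryInc_succ (d : Design (m + 1) n t) (j : Fin (t + 1)) (k : Fin m) :
    ∑ u, carryInc d j (k.succ, u) = periodCount d j k.castSucc := by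
  simp [carryInc, periodCount_eq_sum]

theorem sum_directInc {p : ℕ} (d : Design p n t) (j : Fin (t + 1)) :
    ∑ k, ∑ u, directInc d j (k, u) = replication d j := by
  simp [directInc, replication_eq_sum]

theorem sum_carryInc (d : Design (m + 1) n t) (j : Fin (t + 1)) :
    ∑ k, ∑ u, carryInc d j (k, u) = replicationInit d j := by
  simp [carryInc, replicationInit_eq_sum, Fin.sum_univ_succ]

theorem directInc_dotProduct_directInc {p : ℕ} (d : Design p n t) (i j : Fin (t + 1)) :
    directInc d i ⬝ᵥ directInc d j = if i = j then (replication d i : ℝ) else 0 := by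
  rcases eq_or_ne i j with rfl | h
  · simp [-Finset.sum_boole, dotProduct, directInc, replication_eq_sum, Fintype.sum_prod_type,
      ← ite_and]
  · rw [if_neg h]
    refine Finset.sum_eq_zero fun q _ => ?_
    simp only [directInc]
    split_ifs with h1 h2
    · exact absurd (h1.symm.trans h2) h
    all_goals simp

theorem carryInc_dotProduct_carryInc (d : Design (m + 1) n t) (i j : Fin (t + 1)) :
    carryInc d i ⬝ᵥ carryInc d j = if i = j then (replicationInit d i : ℝ) else 0 := by
  rcases eq_or_ne i j with rfl | h
  · simp [-Finset.sum_boole, dotProduct, carryInc, replicationInit_eq_sum,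
      Fintype.sum_prod_type, Fin.sum_univ_succ, ← ite_and]
  · rw [if_neg h]
    refine Finset.sum_eq_zero fun q _ => ?_
    simp only [carryInc]
    split_ifs with h1 h2
    · exact absurd (Option.some.inj (h1.symm.trans h2)) h
    all_goals simp

theorem directInc_dotProduct_carryInc (d : Design (m + 1) n t) (i j : Fin (t + 1)) :
    directInc d i ⬝ᵥ carryInc d j = precededCount d i j := by
  simp [-Finset.sum_boole, dotProduct, directInc, carryInc, precededCount_eq_sum,
    Fintype.sum_prod_type, Fin.sum_univ_succ, ← ite_and, and_comm]

/-! ### Entries of the centered Gram matrices -/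

theorem center_directInc_directInc (d : Design (m + 1) n t) (i j : Fin (t + 1)) :
    center (m + 1) n (directInc d i) ⬝ᵥ directInc d j =
      (if i = j then (replication d i : ℝ) else 0)
        - (∑ u, (unitCount d i u : ℝ) * unitCount d j u) / (m + 1)
        - (∑ k, (periodCount d i k : ℝ) * periodCount d j k) / n
        + (replication d i : ℝ) * replication d j / ((m + 1) * n) := by
  rw [center_dotProduct, directInc_dotProduct_directInc]
  simp only [sum_periods_directInc, sum_units_directInc, ← Nat.cast_sum, sum_periodCount,
    Nat.cast_add, Nat.cast_one]

theorem center_directInc_carryInc (d : Design (m + 1) n t) (i j : Fin (t + 1)) :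
    center (m + 1) n (directInc d i) ⬝ᵥ carryInc d j =
      (precededCount d i j : ℝ)
        - (∑ u, (unitCount d i u : ℝ) * unitCountInit d j u) / (m + 1)
        - (∑ k : Fin m, (periodCount d i k.succ : ℝ) * periodCount d j k.castSucc) / n
        + (replication d i : ℝ) * replicationInit d j / ((m + 1) * n) := by
  rw [center_dotProduct, directInc_dotProduct_carryInc, sum_carryInc, sum_directInc,
    Fin.sum_univ_succ (n := m)]
  simp only [sum_periods_directInc, sum_periods_carryInc, sum_units_directInc,
    sum_units_carryInc_zero, sum_units_carryInc_succ, Nat.cast_add, Nat.cast_one, mul_zero,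
    zero_add]

theorem center_carryInc_carryInc (d : Design (m + 1) n t) (i j : Fin (t + 1)) :
    center (m + 1) n (carryInc d i) ⬝ᵥ carryInc d j =
      (if i = j then (replicationInit d i : ℝ) else 0)
        - (∑ u, (unitCountInit d i u : ℝ) * unitCountInit d j u) / (m + 1)
        - (∑ k : Fin m, (periodCount d i k.castSucc : ℝ) * periodCount d j k.castSucc) / n
        + (replicationInit d i : ℝ) * replicationInit d j / ((m + 1) * n) := by
  rw [center_dotProduct, carryInc_dotProduct_carryInc, sum_carryInc, sum_carryInc,
    Fin.sum_univ_succ (n := m)]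
  simp only [sum_periods_carryInc, sum_units_carryInc_zero, sum_units_carryInc_succ,
    Nat.cast_add, Nat.cast_one, mul_zero, zero_add]

theorem sum_center_directInc (hn : n ≠ 0) (d : Design (m + 1) n t) :
    center (m + 1) n (directInc d 0) + ∑ i : Fin t, center (m + 1) n (directInc d i.succ) = 0 := by
  rw [← map_sum, ← map_add, ← Fin.sum_univ_succ (f := fun j => directInc d j)]
  rw [← center_additive (m.succ_ne_zero) hn (fun _ => 1) (fun _ => 0)]
  congr 1
  funext q
  simp [directInc]

/-- Summed over all treatments, the carryover vectors give the indicator of the periods after the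
first. This is a pure period effect, which centering kills. -/
theorem sum_center_carryInc (hn : n ≠ 0) (d : Design (m + 1) n t) :
    center (m + 1) n (carryInc d 0) + ∑ i : Fin t, center (m + 1) n (carryInc d i.succ) = 0 := by
  rw [← map_sum, ← map_add, ← Fin.sum_univ_succ (f := fun j => carryInc d j)]
  rw [← center_additive (m.succ_ne_zero) hn (fun k => if k = 0 then 0 else 1) (fun _ => 0)]
  congr 1
  funext ⟨k, u⟩
  cases k using Fin.cases <;> simp [carryInc]

end

end Crossover

namespace Crossover

noncomputable section

variable {m n t : ℕ}

/-! ### Quadratic forms in the centered incidence vectors -/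

theorem center_quad {p : ℕ} (x y : Fin p × Fin n → ℝ) (s : ℝ) :
    center p n (x + s • y) ⬝ᵥ (x + s • y) =
      center p n x ⬝ᵥ x + 2 * s * (center p n x ⬝ᵥ y) + s ^ 2 * (center p n y ⬝ᵥ y) := by
  simp only [map_add, map_smul, add_dotProduct, dotProduct_add, smul_dotProduct, dotProduct_smul,
    smul_eq_mul, center_dotProduct_comm y x]
  ring

/-- Sum of squares of the control counts per unit. -/
def ctrlSq {p : ℕ} (d : Design p n t) : ℕ := ∑ u, unitCount d 0 u ^ 2

/-- Sum of products of the control counts per unit in all and in all but the last period. -/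
def ctrlCross {p : ℕ} (d : Design p n t) : ℕ := ∑ u, unitCount d 0 u * unitCountInit d 0 u

/-- Sum of squares of the control counts per unit in all but the last period. -/
def ctrlSqInit {p : ℕ} (d : Design p n t) : ℕ := ∑ u, unitCountInit d 0 u ^ 2

/-- The vector of direct effects plus `s` times carryover effects of treatment `j`. -/
def mixInc {p : ℕ} (d : Design p n t) (s : ℝ) (j : Fin (t + 1)) : Fin p × Fin n → ℝ :=
  directInc d j + s • carryInc d j

/-! ### Information on the control when it appears equally often in all periods -/

section Control

variable {d : Design (m + 1) n t} {c : ℝ}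

theorem replication_of_periodCount {j : Fin (t + 1)} (hc : ∀ k, (periodCount d j k : ℝ) = c) :
    (replication d j : ℝ) = (m + 1) * c := by
  rw [← sum_periodCount, Nat.cast_sum]
  simp [hc]

theorem replicationInit_of_periodCount {j : Fin (t + 1)}
    (hc : ∀ k, (periodCount d j k : ℝ) = c) : (replicationInit d j : ℝ) = m * c := by
  rw [← sum_periodCount_castSucc, Nat.cast_sum]
  simp [hc]

theorem center_directInc_zero (hn : n ≠ 0) (hc : ∀ k, (periodCount d 0 k : ℝ) = c) :
    center (m + 1) n (directInc d 0) ⬝ᵥ directInc d 0 = (m + 1) * c - ctrlSq d / (m + 1) := by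
  have hn' : (n : ℝ) ≠ 0 := by exact_mod_cast hn
  rw [center_directInc_directInc, replication_of_periodCount hc]
  simp only [hc, if_true, Finset.sum_const, Finset.card_univ, Fintype.card_fin, nsmul_eq_mul,
    ctrlSq, Nat.cast_sum, Nat.cast_pow, ← sq]
  push_cast
  field_simp
  ring

theorem center_directInc_carryInc_zero (hn : n ≠ 0) (hc : ∀ k, (periodCount d 0 k : ℝ) = c)
    (h0 : precededCount d 0 0 = 0) :
    center (m + 1) n (directInc d 0) ⬝ᵥ carryInc d 0 = - (ctrlCross d / (m + 1)) := by
  have hn' : (n : ℝ) ≠ 0 := by exact_mod_cast hn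
  rw [center_directInc_carryInc, replication_of_periodCount hc, replicationInit_of_periodCount hc,
    h0]
  simp only [hc, Finset.sum_const, Finset.card_univ, Fintype.card_fin, nsmul_eq_mul,
    ctrlCross, Nat.cast_sum, Nat.cast_mul]
  push_cast
  field_simp
  ring

theorem center_carryInc_zero (hn : n ≠ 0) (hc : ∀ k, (periodCount d 0 k : ℝ) = c) :
    center (m + 1) n (carryInc d 0) ⬝ᵥ carryInc d 0 =
      m * c - ctrlSqInit d / (m + 1) - m * c ^ 2 / (n * (m + 1)) := by
  have hn' : (n : ℝ) ≠ 0 := by exact_mod_cast hn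
  rw [center_carryInc_carryInc, replicationInit_of_periodCount hc]
  simp only [hc, if_true, Finset.sum_const, Finset.card_univ, Fintype.card_fin, nsmul_eq_mul,
    ctrlSqInit, Nat.cast_sum, Nat.cast_pow, ← sq]
  field_simp
  ring

theorem center_mixInc_zero (hn : n ≠ 0) (hc : ∀ k, (periodCount d 0 k : ℝ) = c)
    (h0 : precededCount d 0 0 = 0) (s : ℝ) :
    (m + 1) * (center (m + 1) n (mixInc d s 0) ⬝ᵥ mixInc d s 0) =
      (m + 1) ^ 2 * c - ctrlSq d - 2 * s * ctrlCross d
        + s ^ 2 * ((m + 1) * m * c - m * c ^ 2 / n - ctrlSqInit d) := by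
  have hn' : (n : ℝ) ≠ 0 := by exact_mod_cast hn
  rw [mixInc, center_quad, center_directInc_zero hn hc, center_directInc_carryInc_zero hn hc h0,
    center_carryInc_zero hn hc]
  field_simp
  ring

end Control

/-- Upper bound for the information on a treatment that never follows itself, eliminating
the unit effects and only the effect of the first period. -/
theorem center_mixInc_le (hm : m ≠ 0) (d : Design (m + 1) n t) (j : Fin (t + 1))
    (h0 : precededCount d j j = 0) {s : ℝ} (hs : 0 ≤ s) :
    center (m + 1) n (mixInc d s j) ⬝ᵥ mixInc d s j ≤
      replication d j + s ^ 2 * replicationInit d j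
        - (replication d j + 2 * s * replicationInit d j + s ^ 2 * replicationInit d j) / (m + 1)
        - (replication d j + s * replicationInit d j - (m + 1) * periodCount d j 0) ^ 2 /
            (n * m * (m + 1)) := by
  have hm' : (0 : ℝ) < m := by exact_mod_cast Nat.pos_of_ne_zero hm
  rw [mixInc, center_quad, center_directInc_directInc, center_directInc_carryInc,
    center_carryInc_carryInc, h0, if_pos rfl, if_pos rfl]
  -- Unit counts are natural numbers, so each is at most its square; equality holds when the
  -- treatment is binary in the units.
  have hunit : (replication d j : ℝ) + 2 * s * replicationInit d j + s ^ 2 * replicationInit d j ≤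
      (∑ u, (unitCount d j u : ℝ) * unitCount d j u)
        + 2 * s * (∑ u, (unitCount d j u : ℝ) * unitCountInit d j u)
        + s ^ 2 * ∑ u, (unitCountInit d j u : ℝ) * unitCountInit d j u := by
    have e1 : (replication d j : ℝ) ≤ ∑ u, (unitCount d j u : ℝ) * unitCount d j u := by
      rw [← sum_unitCount]; exact_mod_cast Finset.sum_le_sum fun u _ => Nat.le_mul_self _
    have e2 : (replicationInit d j : ℝ) ≤
        ∑ u, (unitCountInit d j u : ℝ) * unitCountInit d j u := by
      rw [← sum_unitCountInit]; exact_mod_cast Finset.sum_le_sum fun u _ => Nat.le_mul_self _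
    have e3 : (∑ u, (unitCountInit d j u : ℝ) * unitCountInit d j u) ≤
        ∑ u, (unitCount d j u : ℝ) * unitCountInit d j u := by
      exact_mod_cast Finset.sum_le_sum fun u _ => Nat.mul_le_mul_right _ (unitCountInit_le d j u)
    have := mul_le_mul_of_nonneg_left (e2.trans e3) (by positivity : 0 ≤ 2 * s)
    have := mul_le_mul_of_nonneg_left e2 (by positivity : 0 ≤ s ^ 2)
    linarith
  have hrep : (replication d j : ℝ) = periodCount d j 0 + ∑ k : Fin m, (periodCount d j k.succ : ℝ) := by
    rw [← sum_periodCount, Fin.sum_univ_succ]; push_cast; rfl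
  have hrepI : (replicationInit d j : ℝ) = ∑ k : Fin m, (periodCount d j k.castSucc : ℝ) := by
    rw [← sum_periodCount_castSucc]; push_cast; rfl
  -- Cauchy–Schwarz over the m periods after the first. The first one is kept apart because it
  -- carries no carryover effect.
  have hper : (replication d j - periodCount d j 0 + s * replicationInit d j : ℝ) ^ 2 ≤
      m * ((∑ k : Fin m, (periodCount d j k.succ : ℝ) * periodCount d j k.succ)
        + 2 * s * (∑ k : Fin m, (periodCount d j k.succ : ℝ) * periodCount d j k.castSucc)
        + s ^ 2 * ∑ k : Fin m, (periodCount d j k.castSucc : ℝ) * periodCount d j k.castSucc) := by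
    have h := sq_sum_le_card_mul_sum_sq (s := (Finset.univ : Finset (Fin m)))
      (f := fun k => (periodCount d j k.succ : ℝ) + s * periodCount d j k.castSucc)
    rw [Finset.sum_add_distrib, ← Finset.mul_sum, ← hrepI, Finset.card_univ, Fintype.card_fin]
      at h
    have e : (replication d j - periodCount d j 0 : ℝ) =
        ∑ k : Fin m, (periodCount d j k.succ : ℝ) := by rw [hrep]; ring
    rw [e]
    refine h.trans (le_of_eq ?_)
    congr 1
    rw [Finset.mul_sum, Finset.mul_sum, ← Finset.sum_add_distrib, ← Finset.sum_add_distrib]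
    refine Finset.sum_congr rfl fun k _ => ?_
    ring
  rw [Fin.sum_univ_succ (f := fun k => (periodCount d j k : ℝ) * periodCount d j k)]
  generalize (∑ k : Fin m, (periodCount d j k.succ : ℝ) * periodCount d j k.succ) = P1 at *
  generalize (∑ k : Fin m, (periodCount d j k.succ : ℝ) * periodCount d j k.castSucc) = P2 at *
  generalize (∑ k : Fin m, (periodCount d j k.castSucc : ℝ) * periodCount d j k.castSucc) = P3
    at *
  generalize (∑ u, (unitCount d j u : ℝ) * unitCount d j u) = U1 at *
  generalize (∑ u, (unitCount d j u : ℝ) * unitCountInit d j u) = U2 at *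
  generalize (∑ u, (unitCountInit d j u : ℝ) * unitCountInit d j u) = U3 at *
  clear hrep hrepI h0
  generalize (periodCount d j 0 : ℝ) = h at *
  generalize (replication d j : ℝ) = r at *
  generalize (replicationInit d j : ℝ) = r' at *
  have hU := div_le_div_of_nonneg_right hunit (by positivity : (0 : ℝ) ≤ m + 1)
  -- The period sum of squares is split into the grand total, which cancels against the last term of
  -- the double centering, and the contrast of the first period with the rest.
  have hP : (r + s * r') ^ 2 / (m + 1) + (r + s * r' - (m + 1) * h) ^ 2 / (m * (m + 1)) ≤
      h * h + P1 + 2 * s * P2 + s ^ 2 * P3 := by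
    have e : (r + s * r') ^ 2 / (m + 1) + (r + s * r' - (m + 1) * h) ^ 2 / (m * (m + 1)) =
        h * h + (r - h + s * r') ^ 2 / m := by
      field_simp
      ring
    rw [e]
    have : (r - h + s * r') ^ 2 / m ≤ P1 + 2 * s * P2 + s ^ 2 * P3 := by
      rw [div_le_iff₀ hm']; linarith
    linarith
  have hP' := div_le_div_of_nonneg_right hP (by positivity : (0 : ℝ) ≤ n)
  have e1 : ((r + s * r') ^ 2 / (m + 1) + (r + s * r' - (m + 1) * h) ^ 2 / (m * (m + 1))) / n =
      (r * r / ((m + 1) * n) + 2 * s * (r * r' / ((m + 1) * n))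
        + s ^ 2 * (r' * r' / ((m + 1) * n)))
        + (r + s * r' - (m + 1) * h) ^ 2 / (n * m * (m + 1)) := by
    rw [add_div, div_div, div_div]
    have : (m : ℝ) * (m + 1) * n = n * m * (m + 1) := by ring
    rw [this]
    ring
  have e2 : (h * h + P1 + 2 * s * P2 + s ^ 2 * P3) / n =
    (h * h + P1) / n + 2 * s * (P2 / n) + s ^ 2 * (P3 / n) := by ring
  have e3 : (U1 + 2 * s * U2 + s ^ 2 * U3) / (m + 1) =
    U1 / (m + 1) + 2 * s * (U2 / (m + 1)) + s ^ 2 * (U3 / (m + 1)) := by ring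
  rw [e1, e2] at hP'
  rw [e3] at hU
  push_cast
  linarith

/-- Upper bound for the total information on the test treatments. -/
theorem sum_center_mixInc_le (hm : m ≠ 0) (hn : n ≠ 0) (ht : t ≠ 0) {d : Design (m + 1) n t}
    {c : ℝ} (hc : ∀ k, (periodCount d 0 k : ℝ) = c) (h0 : ∀ j, precededCount d j j = 0)
    {s : ℝ} (hs : 0 ≤ s) :
    t * (m + 1) * (∑ i : Fin t, center (m + 1) n (mixInc d s i.succ) ⬝ᵥ mixInc d s i.succ) ≤
      t * m * (m + 1) * (n - c) - 2 * s * (t * m * (n - c))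
        + s ^ 2 * (t * m ^ 2 * (n - c) - m * (n - c) ^ 2 / n) := by
  have hm' : (0 : ℝ) < m := by exact_mod_cast Nat.pos_of_ne_zero hm
  have hn' : (0 : ℝ) < n := by exact_mod_cast Nat.pos_of_ne_zero hn
  have ht' : (0 : ℝ) < t := by exact_mod_cast Nat.pos_of_ne_zero ht
  have hR : ∑ i : Fin t, (replication d i.succ : ℝ) = (m + 1) * (n - c) := by
    have h := sum_replication d
    have h' : (replication d 0 : ℝ) + ∑ i : Fin t, (replication d i.succ : ℝ) = n * (m + 1) := by
      exact_mod_cast h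
    rw [replication_of_periodCount hc] at h'
    linarith
  have hR' : ∑ i : Fin t, (replicationInit d i.succ : ℝ) = m * (n - c) := by
    have h := sum_replicationInit d
    have h' : (replicationInit d 0 : ℝ) + ∑ i : Fin t, (replicationInit d i.succ : ℝ) = n * m := by
      exact_mod_cast h
    rw [replicationInit_of_periodCount hc] at h'
    linarith
  have hL : ∑ i : Fin t, (periodCount d i.succ 0 : ℝ) = n - c := by
    have h' : (periodCount d 0 0 : ℝ) + ∑ i : Fin t, (periodCount d i.succ 0 : ℝ) = n := by
      exact_mod_cast sum_periodCount_treatments d 0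
    rw [hc] at h'
    linarith
  have hsum := Finset.sum_le_sum fun (i : Fin t) (_ : i ∈ Finset.univ) =>
    center_mixInc_le hm d i.succ (h0 _) hs
  -- Cauchy–Schwarz over the test treatments. In the sum of these first-period contrasts the direct
  -- parts cancel and s·m(n - c) remains.
  have hq := sq_sum_le_card_mul_sum_sq (s := (Finset.univ : Finset (Fin t)))
    (f := fun i => (replication d i.succ : ℝ) + s * replicationInit d i.succ
      - (m + 1) * periodCount d i.succ 0)
  simp only [Finset.sum_sub_distrib, Finset.sum_add_distrib, ← Finset.mul_sum, ← Finset.sum_div,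
    hR, hR', hL, Finset.card_univ, Fintype.card_fin] at hsum hq
  generalize (∑ i : Fin t, ((replication d i.succ : ℝ) + s * replicationInit d i.succ
      - (m + 1) * periodCount d i.succ 0) ^ 2) = W at *
  refine (mul_le_mul_of_nonneg_left hsum (by positivity : (0 : ℝ) ≤ t * (m + 1))).trans ?_
  have hW : (s * (m * (n - c))) ^ 2 ≤ t * W := by
    refine le_trans (le_of_eq ?_) hq
    ring
  have e : (t : ℝ) * (m + 1) * ((m + 1) * (n - c) + s ^ 2 * (m * (n - c)) -
      ((m + 1) * (n - c) + 2 * s * (m * (n - c)) + s ^ 2 * (m * (n - c))) / (m + 1) -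
      W / (n * m * (m + 1))) = t * m * (m + 1) * (n - c) - 2 * s * (t * m * (n - c))
        + s ^ 2 * (t * m ^ 2 * (n - c)) - (t * W) / (n * m) := by
    field_simp
    ring
  rw [e]
  have e2 : s ^ 2 * (m * (n - c) ^ 2 / n) ≤ t * W / (n * m) := by
    rw [le_div_iff₀ (by positivity)]
    refine le_trans (le_of_eq ?_) hW
    field_simp
  linarith

/-! ### Vectors of effects supported on one test treatment and the control -/

/-- Value `a` at the test treatment `i`, value `b` at the control, and `0` elsewhere. -/
def pairEffect (i : Fin t) (a b : ℝ) : Fin (t + 1) → ℝ := Fin.cons b (Pi.single i a)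

theorem effect_pairEffect {p : ℕ} (d : Design p n t) (i : Fin t) (a b a' b' : ℝ) :
    effect d (pairEffect i a b) (pairEffect i a' b') =
      a • directInc d i.succ + b • directInc d 0
        + (a' • carryInc d i.succ + b' • carryInc d 0) := by
  rw [effect, Fin.sum_univ_succ, Finset.sum_add_distrib]
  simp only [pairEffect, Fin.cons_zero, Fin.cons_succ]
  rw [Finset.sum_eq_single i, Finset.sum_eq_single i]
  · simp only [Pi.single_eq_same]
    abel
  all_goals simp +contextual

/-- The effects whose expected responses are the optimal weights for the contrast of
test treatment `i` with the control. -/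
theorem effect_weights {p : ℕ} (d : Design p n t) (i : Fin t) (A B l s : ℝ) :
    effect d (pairEffect i A (A / t - B)) (pairEffect i (l * A) (l * A / t - s * B)) =
      A • (mixInc d l i.succ + (1 / t : ℝ) • mixInc d l 0) - B • mixInc d s 0 := by
  rw [effect_pairEffect]
  simp only [mixInc]
  module

/-- This relation collapses the cross terms in `sum_weights_sq`, so that no individual test-control
product has to be known. -/
theorem sum_center_mixInc (hn : n ≠ 0) (d : Design (m + 1) n t) (s : ℝ) :
    ∑ i : Fin t, center (m + 1) n (mixInc d s i.succ) = - center (m + 1) n (mixInc d s 0) := by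
  have h1 := sum_center_directInc hn d
  have h2 := sum_center_carryInc hn d
  simp only [mixInc, map_add, map_smul, Finset.sum_add_distrib, ← Finset.smul_sum]
  rw [eq_neg_of_add_eq_zero_right h1, eq_neg_of_add_eq_zero_right h2]
  module

/-- Sum over the test treatments of the squared lengths of the optimal weights. -/
theorem sum_weights_sq (hn : n ≠ 0) (ht : t ≠ 0) (d : Design (m + 1) n t) (A B l s : ℝ) :
    ∑ i : Fin t, center (m + 1) n (A • (mixInc d l i.succ + (1 / t : ℝ) • mixInc d l 0)
        - B • mixInc d s 0) ⬝ᵥ (A • (mixInc d l i.succ + (1 / t : ℝ) • mixInc d l 0)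
        - B • mixInc d s 0) =
      A ^ 2 * ((∑ i : Fin t, center (m + 1) n (mixInc d l i.succ) ⬝ᵥ mixInc d l i.succ)
        - center (m + 1) n (mixInc d l 0) ⬝ᵥ mixInc d l 0 / t)
        + t * B ^ 2 * (center (m + 1) n (mixInc d s 0) ⬝ᵥ mixInc d s 0) := by
  have ht' : (t : ℝ) ≠ 0 := by exact_mod_cast ht
  have e : ∀ w, ∑ i : Fin t, center (m + 1) n (mixInc d l i.succ) ⬝ᵥ w =
      -(center (m + 1) n (mixInc d l 0) ⬝ᵥ w) := fun w => by
    rw [← sum_dotProduct, sum_center_mixInc hn, neg_dotProduct]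
  have h : ∀ i : Fin t, center (m + 1) n (A • (mixInc d l i.succ + (1 / t : ℝ) • mixInc d l 0)
        - B • mixInc d s 0) ⬝ᵥ (A • (mixInc d l i.succ + (1 / t : ℝ) • mixInc d l 0)
        - B • mixInc d s 0) =
      A ^ 2 * (center (m + 1) n (mixInc d l i.succ) ⬝ᵥ mixInc d l i.succ)
        + 2 * A ^ 2 / t * (center (m + 1) n (mixInc d l i.succ) ⬝ᵥ mixInc d l 0)
        - 2 * A * B * (center (m + 1) n (mixInc d l i.succ) ⬝ᵥ mixInc d s 0)
        + (A ^ 2 / t ^ 2 * (center (m + 1) n (mixInc d l 0) ⬝ᵥ mixInc d l 0)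
        - 2 * A * B / t * (center (m + 1) n (mixInc d l 0) ⬝ᵥ mixInc d s 0)
        + B ^ 2 * (center (m + 1) n (mixInc d s 0) ⬝ᵥ mixInc d s 0)) := fun i => by
    simp only [map_add, map_sub, map_smul, add_dotProduct, dotProduct_add, smul_dotProduct,
      dotProduct_smul, sub_dotProduct, dotProduct_sub, smul_eq_mul,
      center_dotProduct_comm (mixInc d l 0) (mixInc d l i.succ),
      center_dotProduct_comm (mixInc d s 0) (mixInc d l i.succ),
      center_dotProduct_comm (mixInc d s 0) (mixInc d l 0)]
    ring
  simp only [h, Finset.sum_add_distrib, Finset.sum_sub_distrib, ← Finset.mul_sum, e,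
    Finset.sum_const, Finset.card_univ, Fintype.card_fin, nsmul_eq_mul]
  field_simp
  ring

end

end Crossover

namespace Crossover

/-! ### Comparison of the two parts of the lower bound -/

section Comparison

variable {t m n c S₁ S₂ S₃ : ℝ}

/-- This quantity, called D below, times m is the least value of the denominator X of x₁, reached at
S₃ = mc (`carryover_test_ge`). -/
theorem carryover_test_pos (hm : 2 ≤ m) (hmt : m ≤ t) (hc : 0 < c) (hcn : 2 * c ≤ n) :
    0 < t * m * (n - c) - n - (m - 2) * c := by
  have h1 : m * (m * (n - c)) ≤ t * (m * (n - c)) :=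
    mul_le_mul_of_nonneg_right hmt (mul_nonneg (by linarith) (by linarith))
  have h2 : 2 * (m * (n - c)) ≤ m * (m * (n - c)) :=
    mul_le_mul_of_nonneg_right hm (mul_nonneg (by linarith) (by linarith))
  nlinarith

/-- With E = tn - (t+1)c, the left side mE is the largest possible numerator t·m(n - c) - S₂,
reached at S₂ = mc. The constant 3/2 thus controls the regression coefficient l through l ≤ E/D. -/
theorem three_halves_bound (hm : 2 ≤ m) (hmt : m ≤ t) (hc : 0 < c) (hcn : 2 * c ≤ n) :
    m * (t * n - (t + 1) * c) ≤ 3 / 2 * (t * m * (n - c) - n - (m - 2) * c) := by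
  have h1 : (t - 2) * (m * (n - 2 * c)) ≥ 0 :=
    mul_nonneg (by linarith) (mul_nonneg (by linarith) (by linarith))
  have h2 : (t - 2) * ((m - 2) * c) ≥ 0 :=
    mul_nonneg (by linarith) (mul_nonneg (by linarith) (by linarith))
  have h3 : (t - 2) * c ≥ 0 := mul_nonneg (by linarith) (by linarith)
  have h4 : (m - 2) * c ≥ 0 := mul_nonneg (by linarith) (by linarith)
  have h5 : (m - 2) * (n - 2 * c) ≥ 0 := mul_nonneg (by linarith) (by linarith)
  nlinarith

theorem carryover_control_pos (hm : 2 ≤ m) (hc : 0 < c) (hcn : 2 * c ≤ n)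
    (h3u : S₃ ≤ m ^ 2 * c) : 0 < (m + 1) * m * c - m * c ^ 2 / n - S₃ := by
  have hn : 0 < n := by linarith
  have : m * c ^ 2 / n < m * c := by
    rw [div_lt_iff₀ hn]
    have := mul_pos (mul_pos (by linarith : 0 < m) hc) (by linarith : 0 < n - c)
    nlinarith
  nlinarith

theorem carryover_test_ge (h3 : m * c ≤ S₃) :
    m * (t * m * (n - c) - n - (m - 2) * c) ≤
      n * m * (t * m - 1) - (t * m + m - 1) * (m * c) + S₃ := by
  linarith

/-- The eliminated information on the test treatments. -/
theorem eliminated_test_le (hm : 2 ≤ m) (hmt : m ≤ t) (hc : 0 < c) (hcn : 2 * c ≤ n)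
    (h2 : m * c ≤ S₂) (h2u : S₂ ≤ t * m * (n - c)) (h3 : m * c ≤ S₃) :
    (t * m * (n - c) - S₂) ^ 2 / (n * m * (t * m - 1) - (t * m + m - 1) * (m * c) + S₃) ≤
      3 / 2 * (t * n - (t + 1) * c) := by
  have hD := carryover_test_pos hm hmt hc hcn
  have hx := carryover_test_ge (t := t) (n := n) h3
  have hE := three_halves_bound hm hmt hc hcn
  set D := t * m * (n - c) - n - (m - 2) * c
  set X := n * m * (t * m - 1) - (t * m + m - 1) * (m * c) + S₃
  set a := t * m * (n - c) - S₂ with ha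
  set E := t * n - (t + 1) * c with hEd
  have ha0 : 0 ≤ a := by linarith
  have haE : a ≤ m * E := by rw [ha, hEd]; linarith
  have hX : 0 < X := lt_of_lt_of_le (mul_pos (by linarith) hD) hx
  have hE0 : 0 ≤ E := by
    have : 0 ≤ m * E := ha0.trans haE
    exact nonneg_of_mul_nonneg_right this (by linarith)
  rw [div_le_iff₀ hX]
  have h1 : a ^ 2 ≤ (m * E) ^ 2 := pow_le_pow_left₀ ha0 haE 2
  have h2 : (m * E) * (m * E) ≤ (m * E) * (3 / 2 * D) :=
    mul_le_mul_of_nonneg_left hE (ha0.trans haE)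
  have h3 : E * (m * D) ≤ E * X := mul_le_mul_of_nonneg_left hx hE0
  nlinarith

/-- The information on the test treatments dominates that on the control. -/
theorem control_le_test (hm : 2 ≤ m) (hmt : m ≤ t) (hc : 0 < c) (hcn : 2 * c ≤ n)
    (h1q : (m + 1) ^ 2 * c ^ 2 / n ≤ S₁)
    (h2 : m * c ≤ S₂) (h2u : S₂ ≤ t * m * (n - c)) (h3 : m * c ≤ S₃) (h3u : S₃ ≤ m ^ 2 * c) :
    (t - 1) * ((m + 1) ^ 2 * c - S₁ - S₂ ^ 2 / ((m + 1) * m * c - m * c ^ 2 / n - S₃)) ≤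
      t * m * (m + 1) * (n - c) - ((m + 1) ^ 2 * c - S₁)
        - (t * m * (n - c) - S₂) ^ 2 /
          (n * m * (t * m - 1) - (t * m + m - 1) * (m * c) + S₃) := by
  have hn : 0 < n := by linarith
  have hy := carryover_control_pos hm hc hcn h3u
  have hel := eliminated_test_le hm hmt hc hcn h2 h2u h3
  have hy2 : 0 ≤ S₂ ^ 2 / ((m + 1) * m * c - m * c ^ 2 / n - S₃) :=
    div_nonneg (sq_nonneg _) hy.le
  have hy3 : 0 ≤ (t - 1) * (S₂ ^ 2 / ((m + 1) * m * c - m * c ^ 2 / n - S₃)) :=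
    mul_nonneg (by linarith) hy2
  -- Multiplied by t, this bounds the difference of the two sides before eliminating carryover.
  -- Since 3/2·t(n - c) exceeds the eliminated 3/2·E by 3/2·c, the claim follows.
  have hmain : 3 / 2 * (n - c) ≤ m * (m + 1) * (n - c) - (m + 1) ^ 2 * c + S₁ := by
    have e : m * (m + 1) * (n - c) - (m + 1) ^ 2 * c + (m + 1) ^ 2 * c ^ 2 / n =
        (m + 1) * (n - c) * (m - (m + 1) * (c / n)) := by
      field_simp
      ring
    have hcn' : c / n ≤ 1 / 2 := by rw [div_le_div_iff₀ hn (by norm_num)]; linarith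
    have h5 : (m - 1) / 2 ≤ m - (m + 1) * (c / n) := by nlinarith
    have h6 : 3 / 2 * (n - c) ≤ (m + 1) * (n - c) * ((m - 1) / 2) := by
      have : (n - c) * 3 ≤ (n - c) * ((m + 1) * (m - 1)) :=
        mul_le_mul_of_nonneg_left (by nlinarith) (by linarith)
      linarith
    have h7 : (m + 1) * (n - c) * ((m - 1) / 2) ≤ (m + 1) * (n - c) * (m - (m + 1) * (c / n)) :=
      mul_le_mul_of_nonneg_left h5 (mul_nonneg (by linarith) (by linarith))
    linarith
  have hmain' := mul_le_mul_of_nonneg_left hmain (by linarith : 0 ≤ t)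
  nlinarith

/-- The information on the test treatments dominates that on the control, weighted with the
regression coefficients on the carryover effects. -/
theorem control_le_test_weighted (hm : 2 ≤ m) (hmt : m ≤ t) (hc : 0 < c) (hcn : 2 * c ≤ n)
    (h1 : (m + 1) * c ≤ S₁) (h1q : (m + 1) ^ 2 * c ^ 2 / n ≤ S₁)
    (h2 : m * c ≤ S₂) (h2u : S₂ ≤ t * m * (n - c)) (h3 : m * c ≤ S₃) (h3u : S₃ ≤ m ^ 2 * c)
    (hy : 0 < (m + 1) ^ 2 * c - S₁ - S₂ ^ 2 / ((m + 1) * m * c - m * c ^ 2 / n - S₃)) :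
    (t - 1) * ((m + 1) ^ 2 * c - S₁ - S₂ ^ 2 / ((m + 1) * m * c - m * c ^ 2 / n - S₃)) *
        ((t * m * (n - c) - S₂) /
          (n * m * (t * m - 1) - (t * m + m - 1) * (m * c) + S₃)) ≤
      (t * m * (m + 1) * (n - c) - ((m + 1) ^ 2 * c - S₁)
        - (t * m * (n - c) - S₂) ^ 2 /
          (n * m * (t * m - 1) - (t * m + m - 1) * (m * c) + S₃)) *
        (S₂ / ((m + 1) * m * c - m * c ^ 2 / n - S₃)) := by
  have hn : 0 < n := by linarith
  have hm6 : 6 ≤ m * (m + 1) := by nlinarith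
  have hm0 : 0 < m := by linarith
  have hD := carryover_test_pos hm hmt hc hcn
  have hx := carryover_test_ge (t := t) (n := n) h3
  have h32 := three_halves_bound hm hmt hc hcn
  have hY := carryover_control_pos hm hc hcn h3u
  have hel := eliminated_test_le hm hmt hc hcn h2 h2u h3
  have hii := control_le_test hm hmt hc hcn h1q h2 h2u h3 h3u
  have hYle : (m + 1) * m * c - m * c ^ 2 / n - S₃ ≤ c * m * (m - c / n) := by
    have : m * c ^ 2 / n = c * m * (c / n) := by ring
    rw [this]; nlinarith
  have hDE : (t * n - (t + 1) * c) * (m - c / n) =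
      (t * m * (n - c) - n - (m - 2) * c) + (n - c) * (1 - (t + 1) * (c / n)) := by
    field_simp
    ring
  have haE : t * m * (n - c) - S₂ ≤ m * (t * n - (t + 1) * c) := by linarith
  have hyle : (m + 1) ^ 2 * c - S₁ - S₂ ^ 2 / ((m + 1) * m * c - m * c ^ 2 / n - S₃) ≤
      (m + 1) * m * c := by
    have : 0 ≤ S₂ ^ 2 / ((m + 1) * m * c - m * c ^ 2 / n - S₃) := div_nonneg (sq_nonneg _) hY.le
    linarith
  have ha0 : 0 ≤ t * m * (n - c) - S₂ := by linarith
  have hx11 : m * (m + 1) * (t * n - (t + 1) * c) ≤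
      t * m * (m + 1) * (n - c) - ((m + 1) ^ 2 * c - S₁) := by linarith
  have hcn0 : 0 < c / n := div_pos hc hn
  have hcn1 : c / n ≤ 1 / 2 := by rw [div_le_div_iff₀ hn (by norm_num)]; linarith
  set D := t * m * (n - c) - n - (m - 2) * c
  set X := n * m * (t * m - 1) - (t * m + m - 1) * (m * c) + S₃
  set Y := (m + 1) * m * c - m * c ^ 2 / n - S₃
  set a := t * m * (n - c) - S₂
  set E := t * n - (t + 1) * c with hEd
  set y := (m + 1) ^ 2 * c - S₁ - S₂ ^ 2 / Y
  set x := t * m * (m + 1) * (n - c) - ((m + 1) ^ 2 * c - S₁) - a ^ 2 / X with hxd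
  have hX : 0 < X := lt_of_lt_of_le (mul_pos hm0 hD) hx
  have hE0 : 0 ≤ E := nonneg_of_mul_nonneg_right (ha0.trans haE) hm0
  -- The coefficients are compared through their extremes: l ≤ E/D and s ≥ 1/(m - c/n). Whether E/D
  -- ≤ 1/(m - c/n) depends only on the sign of n - (t+1)c.
  have hl : a / X ≤ E / D := by
    rw [div_le_div_iff₀ hX hD]
    have e1 := mul_le_mul_of_nonneg_right haE hD.le
    have e2 := mul_le_mul_of_nonneg_left hx hE0
    linarith
  have hmc : 0 < m - c / n := by linarith
  have hμ : 1 / (m - c / n) ≤ S₂ / Y := by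
    rw [div_le_div_iff₀ hmc hY]
    have e1 := mul_le_mul_of_nonneg_right h2 hmc.le
    linarith
  have ht1 : 0 ≤ (t - 1) * y := mul_nonneg (by linarith) hy.le
  have hx0 : 0 ≤ x := ht1.trans hii
  rcases le_total 1 ((t + 1) * (c / n)) with h | h
  -- Frequent control: l ≤ s, and the unweighted comparison suffices.
  · have h5 : E / D ≤ 1 / (m - c / n) := by
      rw [div_le_div_iff₀ hD hmc, hDE]
      have : 0 ≤ (n - c) * ((t + 1) * (c / n) - 1) := mul_nonneg (by linarith) (by linarith)
      linarith
    exact mul_le_mul hii ((hl.trans h5).trans hμ) (div_nonneg ha0 hX.le) hx0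
  -- Rare control: l may exceed s, but by a factor of at most 3/2. The smallness of c then
  -- strengthens the unweighted comparison by the same factor.
  · have h5 : E / D ≤ 3 / 2 * (1 / (m - c / n)) := by
      rw [mul_one_div, div_le_div_iff₀ hD hmc]
      have : E * (m - c / n) ≤ E * m := mul_le_mul_of_nonneg_left (by linarith) hE0
      linarith
    have h6 : (t - 1) * y * (3 / 2) ≤ x := by
      have hc' : (t + 1) * c ≤ n := by
        have : (t + 1) * (c / n) = (t + 1) * c / n := by ring
        rw [this, div_le_one hn] at h
        exact h
      have e1 : 2 * ((t - 1) * c) ≤ E := by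
        have : t * ((t + 1) * c) ≤ t * n := mul_le_mul_of_nonneg_left hc' (by linarith)
        have := mul_nonneg (sq_nonneg (t - 1)) hc.le
        rw [hEd]
        linarith
      have e2 : 6 * E ≤ m * (m + 1) * E := mul_le_mul_of_nonneg_right hm6 hE0
      have e3 : (t - 1) * y ≤ (t - 1) * ((m + 1) * m * c) :=
        mul_le_mul_of_nonneg_left hyle (by linarith)
      have e4 : m * (m + 1) * (2 * ((t - 1) * c)) ≤ m * (m + 1) * E :=
        mul_le_mul_of_nonneg_left e1 (by linarith)
      linarith
    have h7 : (t - 1) * y * (a / X) ≤ (t - 1) * y * (3 / 2 * (1 / (m - c / n))) :=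
      mul_le_mul_of_nonneg_left (hl.trans h5) ht1
    have h8 : (t - 1) * y * (3 / 2) * (1 / (m - c / n)) ≤ x * (S₂ / Y) :=
      mul_le_mul h6 hμ (by positivity) hx0
    linarith

end Comparison

end Crossover

namespace Crossover

variable {m n t : ℕ}

/-! ### Control counts in the class of competing designs -/

/-- Hypotheses on a competing design, with the constant number `c` of control units per period. -/
structure IsCompeting (d : Design (m + 1) n t) (c : ℝ) : Prop where
  period : ∀ k, (periodCount d 0 k : ℝ) = c
  no_self : ∀ j, precededCount d j j = 0

theorem isCompeting_of_mem {d : Design (m + 1) n t} {r : ℕ} (hd : d ∈ Lam t n (m + 1))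
    (hr : replication d 0 = r) : IsCompeting d ((r : ℝ) / (m + 1)) where
  period k := by rw [hd.1 k, hr]; push_cast; rfl
  no_self := hd.2

theorem not_repeated {d : Design (m + 1) n t} {j : Fin (t + 1)} (h : precededCount d j j = 0)
    (k : Fin m) (u : Fin n) (h1 : d k.castSucc u = j) : d k.succ u ≠ j := by
  intro h2
  rw [precededCount, Finset.card_eq_zero, Finset.filter_eq_empty_iff] at h
  exact h (Finset.mem_univ (k.succ, u)) ⟨h2, by rw [preceding_succ, h1]⟩

namespace IsCompeting

variable {d : Design (m + 1) n t} {c : ℝ}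

theorem exists_control (h : IsCompeting d c) (hc : 0 < c) (k : Fin (m + 1)) :
    ∃ u, d k u = 0 := by
  have h1 : (0 : ℝ) < periodCount d 0 k := by rw [h.period]; exact hc
  have h2 : 0 < periodCount d 0 k := by exact_mod_cast h1
  obtain ⟨u, hu⟩ := Finset.card_pos.1 h2
  exact ⟨u, (Finset.mem_filter.1 hu).2⟩

/-- The units receiving the control in the first two periods are disjoint, because the control never
follows itself. -/
theorem two_mul_le (h : IsCompeting d c) (hm : 0 < m) : 2 * c ≤ n := by
  have h1 : periodCount d 0 (Fin.castSucc ⟨0, hm⟩) + periodCount d 0 (Fin.succ ⟨0, hm⟩) ≤ n := by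
    unfold periodCount
    rw [← Finset.card_union_of_disjoint]
    · exact (Finset.card_le_univ _).trans (by simp)
    · rw [Finset.disjoint_filter]
      exact fun u _ hu => not_repeated (h.no_self 0) _ u hu
  have h2 : (periodCount d 0 (Fin.castSucc ⟨0, hm⟩) : ℝ) + periodCount d 0 (Fin.succ ⟨0, hm⟩) ≤ n :=
    by exact_mod_cast h1
  rw [h.period, h.period] at h2
  linarith

theorem unitCount_le (h : IsCompeting d c) (hm : 0 < m) (u : Fin n) : unitCount d 0 u ≤ m := by
  have : ∃ k, d k u ≠ 0 := by
    by_cases h0 : d (Fin.castSucc ⟨0, hm⟩) u = 0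
    · exact ⟨_, not_repeated (h.no_self 0) _ u h0⟩
    · exact ⟨_, h0⟩
  obtain ⟨k, hk⟩ := this
  have := Finset.card_lt_univ_of_notMem
    (s := Finset.univ.filter fun k : Fin (m + 1) => d k u = 0) (x := k) (by simpa using hk)
  rw [Fintype.card_fin] at this
  exact Nat.lt_succ_iff.1 this

theorem sum_unitCount_eq (h : IsCompeting d c) :
    ∑ u, (unitCount d 0 u : ℝ) = (m + 1) * c := by
  rw [← replication_of_periodCount h.period, ← sum_unitCount, Nat.cast_sum]

theorem sum_unitCountInit_eq (h : IsCompeting d c) :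
    ∑ u, (unitCountInit d 0 u : ℝ) = m * c := by
  rw [← replicationInit_of_periodCount h.period, ← sum_unitCountInit, Nat.cast_sum]

theorem le_ctrlSq (h : IsCompeting d c) : (m + 1) * c ≤ ctrlSq d := by
  rw [← h.sum_unitCount_eq, ctrlSq]
  exact_mod_cast Finset.sum_le_sum fun u _ => Nat.le_self_pow two_ne_zero _

theorem sq_div_le_ctrlSq (h : IsCompeting d c) (hn : 0 < n) :
    (m + 1) ^ 2 * c ^ 2 / n ≤ ctrlSq d := by
  have h1 := sq_sum_le_card_mul_sum_sq (s := (Finset.univ : Finset (Fin n)))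
    (f := fun u => (unitCount d 0 u : ℝ))
  rw [h.sum_unitCount_eq, Finset.card_univ, Fintype.card_fin, mul_pow] at h1
  rw [div_le_iff₀ (by exact_mod_cast hn), ctrlSq]
  push_cast
  linarith

theorem le_ctrlSqInit (h : IsCompeting d c) : m * c ≤ ctrlSqInit d := by
  rw [← h.sum_unitCountInit_eq, ctrlSqInit]
  exact_mod_cast Finset.sum_le_sum fun u _ => Nat.le_self_pow two_ne_zero _

theorem le_ctrlCross (h : IsCompeting d c) : m * c ≤ ctrlCross d := by
  refine h.le_ctrlSqInit.trans ?_
  rw [ctrlSqInit, ctrlCross]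
  simp only [sq]
  exact_mod_cast Finset.sum_le_sum fun u _ => Nat.mul_le_mul_right _ (unitCountInit_le d 0 u)

theorem ctrlSqInit_le (h : IsCompeting d c) : (ctrlSqInit d : ℝ) ≤ m ^ 2 * c := by
  have e : (m : ℝ) ^ 2 * c = ∑ u, (m : ℝ) * unitCountInit d 0 u := by
    rw [← Finset.mul_sum, h.sum_unitCountInit_eq]; ring
  rw [e, ctrlSqInit]
  simp only [sq]
  exact_mod_cast Finset.sum_le_sum fun u _ =>
    Nat.mul_le_mul_right _ (unitCountInit_le_periods d 0 u)

theorem ctrlCross_le (h : IsCompeting d c) (hm : 0 < m) (hmt : m ≤ t) (hc : 0 ≤ c) :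
    (ctrlCross d : ℝ) ≤ t * m * (n - c) := by
  have h1 : (ctrlCross d : ℝ) ≤ ∑ u, (m : ℝ) * unitCountInit d 0 u := by
    rw [ctrlCross]
    exact_mod_cast Finset.sum_le_sum fun u _ => Nat.mul_le_mul_right _ (h.unitCount_le hm u)
  rw [← Finset.mul_sum, h.sum_unitCountInit_eq] at h1
  have h2 := h.two_mul_le hm
  have h3 : (m : ℝ) ≤ t := by exact_mod_cast hmt
  have h4 : (m : ℝ) * (m * c) ≤ t * (m * (n - c)) :=
    mul_le_mul h3 (mul_le_mul_of_nonneg_left (by linarith) (Nat.cast_nonneg m))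
      (by positivity) (Nat.cast_nonneg t)
  linarith

/-- The two control counts of a unit differ by 0 or 1, so the sum of their squared differences is
the number of controls in the last period. Minimizing both sums of squares thus minimizes the cross
sum. -/
theorem two_mul_ctrlCross (h : IsCompeting d c) :
    2 * (ctrlCross d : ℝ) = ctrlSq d + ctrlSqInit d - c := by
  have h1 : (c : ℝ) = ∑ u, if d (Fin.last m) u = 0 then (1 : ℝ) else 0 := by
    rw [← h.period (Fin.last m), periodCount_eq_sum]
    push_cast
    rfl
  rw [h1, ctrlCross, ctrlSq, ctrlSqInit]
  push_cast
  rw [Finset.mul_sum, ← Finset.sum_add_distrib, ← Finset.sum_sub_distrib]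
  refine Finset.sum_congr rfl fun u _ => ?_
  rw [unitCount_eq_add_last]
  split_ifs <;> push_cast <;> ring

/-- The carryover-adjusted information on the control is positive. -/
theorem center_mixInc_pos (h : IsCompeting d c) (hm : 2 ≤ m) (hn : n ≠ 0) (hc : 0 < c) (s : ℝ) :
    0 < center (m + 1) n (mixInc d s 0) ⬝ᵥ mixInc d s 0 := by
  rw [← center_dotProduct_center m.succ_ne_zero hn]
  refine lt_of_le_of_ne (Finset.sum_nonneg fun q _ => mul_self_nonneg _) fun h0 => ?_
  have hz : center (m + 1) n (mixInc d s 0) = 0 := dotProduct_self_eq_zero.1 h0.symm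
  -- A vector killed by centering is additive, so the difference between two units is the same in
  -- all periods. For units having the control in the first and in the second period respectively,
  -- it is 1, s - 1 and at most 1 - s in the first three periods; this forces s = 2 and 1 ≤ -1.
  have tetrad : ∀ k k' u u', mixInc d s 0 (k, u) - mixInc d s 0 (k, u')
      = mixInc d s 0 (k', u) - mixInc d s 0 (k', u') := fun k k' u u' => by
    have e : ∀ q, center (m + 1) n (mixInc d s 0) q = 0 := fun q => by rw [hz]; rfl
    have e1 := e (k, u)
    have e2 := e (k, u')
    have e3 := e (k', u)
    have e4 := e (k', u')
    rw [center_apply] at e1 e2 e3 e4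
    linarith
  let i : Fin m := ⟨0, by omega⟩
  let j : Fin m := ⟨1, by omega⟩
  obtain ⟨u, hu⟩ := h.exists_control hc i.castSucc
  obtain ⟨u', hu'⟩ := h.exists_control hc i.succ
  have hi : i.castSucc = 0 := rfl
  have hj : j.castSucc = i.succ := rfl
  have hu1 : d i.succ u ≠ 0 := not_repeated (h.no_self 0) i u hu
  have hu'0 : d i.castSucc u' ≠ 0 := fun h1 => not_repeated (h.no_self 0) i u' h1 hu'
  have hu'2 : d j.succ u' ≠ 0 := not_repeated (h.no_self 0) j u' (hj ▸ hu')
  have v0 : ∀ w, mixInc d s 0 (0, w) = if d i.castSucc w = 0 then 1 else 0 := fun w => by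
    simp [mixInc, directInc, carryInc, hi]
  have vs : ∀ (k : Fin m) w, mixInc d s 0 (k.succ, w) =
      (if d k.succ w = 0 then 1 else 0) + s * if d k.castSucc w = 0 then 1 else 0 := fun k w => by
    simp [mixInc, directInc, carryInc]
  have t1 := tetrad i.succ 0 u u'
  have t2 := tetrad j.succ 0 u u'
  rw [vs, vs, v0, v0, if_neg hu1, if_pos hu, if_pos hu', if_neg hu'0] at t1
  rw [vs, vs, v0, v0, hj, if_neg hu1, if_pos hu, if_pos hu', if_neg hu'0, if_neg hu'2] at t2
  split_ifs at t2 <;> linarith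

end IsCompeting

/-! ### The minima over the class -/

section Minima

variable {r : ℕ} {p : ℕ}

theorem minOver_le {d : Design p n t} (hd : d ∈ Lam t n p) (hr : replication d 0 = r)
    (f : Design p n t → ℕ) : minOver t n p r f ≤ f d :=
  Nat.sInf_le ⟨d, hd, hr, rfl⟩

theorem exists_minOver_eq {d : Design p n t} (hd : d ∈ Lam t n p) (hr : replication d 0 = r)
    (f : Design p n t → ℕ) :
    ∃ d' ∈ Lam t n p, replication d' 0 = r ∧ f d' = minOver t n p r f :=
  Nat.sInf_mem (s := {s | ∃ d ∈ Lam t n p, replication d 0 = r ∧ f d = s}) ⟨_, d, hd, hr, rfl⟩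

end Minima

/-! ### The bound in terms of the number of control units per period -/

theorem x₁_eq (t n m r : ℕ) {c : ℝ} (hc : c = (r : ℝ) / (m + 1)) :
    x₁ t n (m + 1) r = t * m * (m + 1) * (n - c) - ((m + 1) ^ 2 * c - minSq t n (m + 1) r)
      - (t * m * (n - c) - minCross t n (m + 1) r) ^ 2 /
        (n * m * (t * m - 1) - (t * m + m - 1) * (m * c) + minSqInit t n (m + 1) r) := by
  have hr : (r : ℝ) = (m + 1) * c := by rw [hc]; field_simp
  have hI : rInit (m + 1) r = m * c := by
    rw [rInit, hr]; push_cast; field_simp; ring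
  rw [x₁, hI, hr]
  push_cast
  congr 1
  · field_simp
    ring
  · congr 1 <;> ring

theorem y₁_eq (t n m r : ℕ) {c : ℝ} (hc : c = (r : ℝ) / (m + 1)) (hm : m ≠ 0) (hn : n ≠ 0) :
    y₁ t n (m + 1) r = (m + 1) ^ 2 * c - minSq t n (m + 1) r
      - (minCross t n (m + 1) r : ℝ) ^ 2 /
        ((m + 1) * m * c - m * c ^ 2 / n - minSqInit t n (m + 1) r) := by
  have hm' : (m : ℝ) ≠ 0 := by exact_mod_cast hm
  have hn' : (n : ℝ) ≠ 0 := by exact_mod_cast hn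
  have hr : (r : ℝ) = (m + 1) * c := by rw [hc]; field_simp
  have hI : rInit (m + 1) r = m * c := by
    rw [rInit, hr]; push_cast; field_simp; ring
  rw [y₁, hI, hr]
  push_cast
  congr 1
  · field_simp
  · rw [← mul_div_mul_left _ ((m + 1) * m * c - m * c ^ 2 / n - (minSqInit t n (m + 1) r : ℝ))
      (mul_ne_zero hn' hm')]
    congr 1
    · ring
    · field_simp
      ring

/-- Completing the square. -/
theorem sub_sq_div_eq (a b e : ℝ) (he : e ≠ 0) :
    a - b ^ 2 / e = a - 2 * (b / e) * b + (b / e) ^ 2 * e := by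
  field_simp
  ring

/-- The weights that are optimal for the minima of the control counts give a lower bound for all
designs with the same control replication. -/
theorem weights_bound {t M x y l s U K V Δ₁ Δ₂ Δ₃ : ℝ} (ht : 1 ≤ t) (hM : 0 < M) (hx : 0 < x)
    (hy : 0 < y) (hl : 0 ≤ l) (h1 : 0 ≤ Δ₁) (h2 : 0 ≤ Δ₂) (h3 : 0 ≤ Δ₃)
    (hxy : (t - 1) * y ≤ x) (hxyl : (t - 1) * y * l ≤ x * s)
    (hU : t * M * U - M * K ≤ x + (Δ₁ + 2 * l * Δ₂ + l ^ 2 * Δ₃))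
    (hV : M * V = y - (Δ₁ + 2 * s * Δ₂ + s ^ 2 * Δ₃)) :
    t * (t - 1) ^ 2 * M / x + t * M / y ≤
      t * (2 * ((t - 1) * t * M / x - ((t - 1) * t * M / x / t - M / y)))
        - (((t - 1) * t * M / x) ^ 2 * (U - K / t) + t * (M / y) ^ 2 * V) := by
  have ht0 : 0 < t := by linarith
  have ha : 0 ≤ (t - 1) / x := div_nonneg (by linarith) hx.le
  have hb : 0 < 1 / y := one_div_pos.2 hy
  have hab : (t - 1) / x ≤ 1 / y := by rw [div_le_div_iff₀ hx hy]; linarith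
  have habl : (t - 1) / x * l ≤ 1 / y * s := by
    rw [div_mul_eq_mul_div, div_mul_eq_mul_div, div_le_div_iff₀ hx hy]; linarith
  have e1 : ((t - 1) * t * M / x) ^ 2 * (U - K / t) =
      t * M * ((t - 1) / x) ^ 2 * (t * M * U - M * K) := by
    field_simp
  have e2 : t * (M / y) ^ 2 * V = t * M * (1 / y) ^ 2 * (M * V) := by
    field_simp
  have e3 : t * (2 * ((t - 1) * t * M / x - ((t - 1) * t * M / x / t - M / y))) =
      2 * (t * (t - 1) ^ 2 * M / x + t * M / y) := by
    field_simp
    ring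
  have e4 : t * (t - 1) ^ 2 * M / x + t * M / y =
      t * M * (((t - 1) / x) ^ 2 * x + (1 / y) ^ 2 * y) := by
    field_simp
  rw [e1, e2, e3, hV, e4]
  set a := (t - 1) / x
  set b := 1 / y
  -- The possible loss in the test part is outweighed by the gain in the control part, coefficient
  -- by coefficient: a ≤ b, al ≤ bs, and their products.
  have hk : a ^ 2 * (Δ₁ + 2 * l * Δ₂ + l ^ 2 * Δ₃) ≤ b ^ 2 * (Δ₁ + 2 * s * Δ₂ + s ^ 2 * Δ₃) := by
    have al : 0 ≤ a * l := mul_nonneg ha hl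
    have k1 : a ^ 2 * Δ₁ ≤ b ^ 2 * Δ₁ :=
      mul_le_mul_of_nonneg_right (pow_le_pow_left₀ ha hab 2) h1
    have k2 : a * (a * l) * Δ₂ ≤ b * (b * s) * Δ₂ :=
      mul_le_mul_of_nonneg_right (mul_le_mul hab habl al hb.le) h2
    have k3 : (a * l) ^ 2 * Δ₃ ≤ (b * s) ^ 2 * Δ₃ :=
      mul_le_mul_of_nonneg_right (pow_le_pow_left₀ al habl 2) h3
    linarith
  have hk' : a ^ 2 * (t * M * U - M * K) ≤ a ^ 2 * x + a ^ 2 * (Δ₁ + 2 * l * Δ₂ + l ^ 2 * Δ₃) := by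
    rw [← mul_add]
    exact mul_le_mul_of_nonneg_left hU (sq_nonneg a)
  have := mul_le_mul_of_nonneg_left (hk'.trans (add_le_add_right hk _))
    (mul_nonneg ht0.le hM.le)
  linarith

theorem ofReal_sum_le {ι : Type*} (s : Finset ι) (f : ι → ℝ) :
    ENNReal.ofReal (∑ i ∈ s, f i) ≤ ∑ i ∈ s, ENNReal.ofReal (f i) := by
  classical
  induction s using Finset.induction_on with
  | empty => simp
  | insert a s ha ih =>
    rw [Finset.sum_insert ha, Finset.sum_insert ha]
    exact ENNReal.ofReal_add_le.trans (add_le_add_right ih _)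

theorem pairEffect_sub (i : Fin t) (a b : ℝ) :
    pairEffect i a b i.succ - pairEffect i a b 0 = a - b := by
  simp [pairEffect]

/-- Properties of the two parts of the lower bound for a possible control replication. -/
structure BoundParts (t n m : ℕ) (c x y S₁ S₂ S₃ X Y : ℝ) : Prop where
  X_def : X = n * m * (t * m - 1) - (t * m + m - 1) * (m * c) + S₃
  Y_def : Y = (m + 1) * m * c - m * c ^ 2 / n - S₃
  X_pos : 0 < X
  Y_pos : 0 < Y
  x_pos : 0 < x
  y_pos : 0 < y
  coef_nonneg : 0 ≤ t * m * (n - c) - S₂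
  x_eq : x = t * m * (m + 1) * (n - c) - ((m + 1) ^ 2 * c - S₁)
    - 2 * ((t * m * (n - c) - S₂) / X) * (t * m * (n - c) - S₂)
    + ((t * m * (n - c) - S₂) / X) ^ 2 * X
  y_eq : y = (m + 1) ^ 2 * c - S₁ - 2 * (S₂ / Y) * S₂ + (S₂ / Y) ^ 2 * Y
  dominated : (t - 1) * y ≤ x
  dominated_weighted : (t - 1) * y * ((t * m * (n - c) - S₂) / X) ≤ x * (S₂ / Y)

/-- The three minima may come from different designs. Each minimum inherits its range from a design
attaining it, and the comparison inequalities use only these ranges and y₁ > 0. -/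
theorem boundParts (hm : 2 ≤ m) (hmt : m ≤ t) {d : Design (m + 1) n t} {r : ℕ}
    (hd : d ∈ Lam t n (m + 1)) (hr : replication d 0 = r) (hr0 : 0 < r) :
    ∃ X Y, BoundParts t n m ((r : ℝ) / (m + 1)) (x₁ t n (m + 1) r) (y₁ t n (m + 1) r)
      (minSq t n (m + 1) r) (minCross t n (m + 1) r) (minSqInit t n (m + 1) r) X Y := by
  have hcomp := isCompeting_of_mem hd hr
  obtain ⟨d₁, hd₁, hr₁, hS₁⟩ := exists_minOver_eq hd hr ctrlSq
  obtain ⟨d₂, hd₂, hr₂, hS₂⟩ := exists_minOver_eq hd hr ctrlCross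
  obtain ⟨d₃, hd₃, hr₃, hS₃⟩ := exists_minOver_eq hd hr ctrlSqInit
  have hc₁ := isCompeting_of_mem hd₁ hr₁
  have hc₂ := isCompeting_of_mem hd₂ hr₂
  have hc₃ := isCompeting_of_mem hd₃ hr₃
  have l1 : minSq t n (m + 1) r ≤ ctrlSq d := minOver_le hd hr ctrlSq
  have l2 : minCross t n (m + 1) r ≤ ctrlCross d := minOver_le hd hr ctrlCross
  have l3 : minSqInit t n (m + 1) r ≤ ctrlSqInit d := minOver_le hd hr ctrlSqInit
  have m1 : ctrlSq d₁ = minSq t n (m + 1) r := hS₁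
  have m2 : ctrlCross d₂ = minCross t n (m + 1) r := hS₂
  have m3 : ctrlSqInit d₃ = minSqInit t n (m + 1) r := hS₃
  have hc : 0 < (r : ℝ) / (m + 1) := by positivity
  rw [x₁_eq t n m r rfl]
  generalize hcr : (r : ℝ) / (m + 1) = c at *
  have h2c := hcomp.two_mul_le (by omega)
  have hn' : (0 : ℝ) < n := by linarith
  have hn : 0 < n := by exact_mod_cast hn'
  rw [y₁_eq t n m r hcr.symm (by omega) hn.ne']
  have b1 := hc₁.le_ctrlSq
  have b1q := hc₁.sq_div_le_ctrlSq hn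
  have b2 := hc₂.le_ctrlCross
  have b2u := hc₂.ctrlCross_le (by omega) hmt hc.le
  have b3 := hc₃.le_ctrlSqInit
  have b3u := hc₃.ctrlSqInit_le
  rw [m1] at b1 b1q
  rw [m2] at b2 b2u
  rw [m3] at b3 b3u
  have hm' : (2 : ℝ) ≤ m := by exact_mod_cast hm
  have hmt' : (m : ℝ) ≤ t := by exact_mod_cast hmt
  have hX : (0 : ℝ) < n * m * (t * m - 1) - (t * m + m - 1) * (m * c) + minSqInit t n (m + 1) r :=
    lt_of_lt_of_le (mul_pos (by linarith) (carryover_test_pos hm' hmt' hc h2c))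
      (carryover_test_ge b3)
  have hY := carryover_control_pos hm' hc h2c b3u
  have q1 : (minSq t n (m + 1) r : ℝ) ≤ ctrlSq d := by exact_mod_cast l1
  have q2 : (minCross t n (m + 1) r : ℝ) ≤ ctrlCross d := by exact_mod_cast l2
  have q3 : (minSqInit t n (m + 1) r : ℝ) ≤ ctrlSqInit d := by exact_mod_cast l3
  have hyeq := sub_sq_div_eq ((m + 1) ^ 2 * c - minSq t n (m + 1) r)
    (minCross t n (m + 1) r) _ hY.ne'
  -- At s = S₂/Y ≥ 0, replacing the minima by the larger counts of `d` turns y₁ into m + 1 times the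
  -- information of `center_mixInc_pos`, which is positive.
  have hy : 0 < (m + 1) ^ 2 * c - minSq t n (m + 1) r - (minCross t n (m + 1) r : ℝ) ^ 2 /
      ((m + 1) * m * c - m * c ^ 2 / n - minSqInit t n (m + 1) r) := by
    rw [hyeq]
    have hs : 0 ≤ (minCross t n (m + 1) r : ℝ) /
      ((m + 1) * m * c - m * c ^ 2 / n - minSqInit t n (m + 1) r) :=
      div_nonneg (Nat.cast_nonneg _) hY.le
    generalize (minCross t n (m + 1) r : ℝ) /
      ((m + 1) * m * c - m * c ^ 2 / n - minSqInit t n (m + 1) r) = s at hs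
    have hp := mul_pos (by positivity : (0 : ℝ) < m + 1)
      (hcomp.center_mixInc_pos hm hn.ne' hc s)
    rw [center_mixInc_zero hn.ne' hcomp.period (hcomp.no_self 0)] at hp
    have w2 := mul_le_mul_of_nonneg_left q2 hs
    have w3 := mul_le_mul_of_nonneg_left q3 (sq_nonneg s)
    linarith
  have hdom := control_le_test hm' hmt' hc h2c b1q b2 b2u b3 b3u
  exact ⟨_, _,
    { X_def := rfl
      Y_def := rfl
      X_pos := hX
      Y_pos := hY
      x_pos := lt_of_lt_of_le (mul_pos (by linarith) hy) hdom
      y_pos := hy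
      coef_nonneg := by linarith
      x_eq := sub_sq_div_eq _ _ _ hX.ne'
      y_eq := hyeq
      dominated := hdom
      dominated_weighted := control_le_test_weighted hm' hmt' hc h2c b1 b1q b2 b2u b3 b3u hy }⟩

/-- The lower bound for the sum of the variances. -/
theorem le_sum_contrastVar (hm : 2 ≤ m) (hmt : m ≤ t) {d : Design (m + 1) n t} {r : ℕ}
    (hd : d ∈ Lam t n (m + 1)) (hr : replication d 0 = r) (hr0 : 0 < r) (v : ℝ≥0) :
    ENNReal.ofReal (v * lowerBound t n (m + 1) r) ≤ ∑ i, contrastVar d v i := by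
  obtain ⟨X, Y, hP⟩ := boundParts hm hmt hd hr hr0
  have hcomp := isCompeting_of_mem hd hr
  have q1 : (minSq t n (m + 1) r : ℝ) ≤ ctrlSq d := by exact_mod_cast minOver_le hd hr ctrlSq
  have q2 : (minCross t n (m + 1) r : ℝ) ≤ ctrlCross d := by
    exact_mod_cast minOver_le hd hr ctrlCross
  have q3 : (minSqInit t n (m + 1) r : ℝ) ≤ ctrlSqInit d := by
    exact_mod_cast minOver_le hd hr ctrlSqInit
  have hc : 0 < (r : ℝ) / (m + 1) := by positivity
  rw [lowerBound]
  generalize x₁ t n (m + 1) r = x at *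
  generalize y₁ t n (m + 1) r = y at *
  generalize (minSq t n (m + 1) r : ℝ) = S₁ at *
  generalize (minCross t n (m + 1) r : ℝ) = S₂ at *
  generalize (minSqInit t n (m + 1) r : ℝ) = S₃ at *
  generalize (r : ℝ) / (m + 1) = c at *
  have h2c := hcomp.two_mul_le (by omega)
  have hn' : (0 : ℝ) < n := by linarith
  have hn : n ≠ 0 := by
    rintro rfl
    simp at hn'
  have ht : t ≠ 0 := by omega
  have ht' : (2 : ℝ) ≤ t := by exact_mod_cast hm.trans hmt
  obtain ⟨hXd, hYd, hX, hY, hx, hy, ha, hxe, hye, hdom, hdomw⟩ := hP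
  set l := (t * m * (n - c) - S₂) / X
  set s := S₂ / Y
  have hl : 0 ≤ l := div_nonneg ha hX.le
  have hU := sum_center_mixInc_le (by omega) hn ht hcomp.period hcomp.no_self hl
  have hK := center_mixInc_zero hn hcomp.period (hcomp.no_self 0) l
  have hV := center_mixInc_zero hn hcomp.period (hcomp.no_self 0) s
  -- With p = m + 1, the multipliers A = (t-1)tp/x and B = p/y maximize 2((t-1)A + tB) - A²x/(tp) -
  -- tB²y/p, whose maximum is the lower bound.
  have hw := sum_weights_sq hn ht d ((t - 1) * t * (m + 1) / x) ((m + 1) / y) l s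
  generalize hUe : (∑ i : Fin t, center (m + 1) n (mixInc d l i.succ) ⬝ᵥ mixInc d l i.succ) = U
    at *
  generalize hKe : center (m + 1) n (mixInc d l 0) ⬝ᵥ mixInc d l 0 = K at *
  generalize hVe : center (m + 1) n (mixInc d s 0) ⬝ᵥ mixInc d s 0 = V at *
  have hUK : t * (m + 1) * U - (m + 1) * K ≤
      x + ((ctrlSq d - S₁) + 2 * l * (ctrlCross d - S₂) + l ^ 2 * (ctrlSqInit d - S₃)) := by
    rw [hK]
    -- The c²/n terms of the test and control parts cancel, which leaves X as the coefficient of l².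
    have e : l ^ 2 * (t * m ^ 2 * (n - c) - m * (n - c) ^ 2 / n) =
        l ^ 2 * (X - S₃ + ((m + 1) * m * c - m * c ^ 2 / n)) := by
      rw [hXd]
      congr 1
      field_simp
      ring
    rw [e] at hU
    rw [hxe]
    linarith
  have hV' : (m + 1) * V =
      y - ((ctrlSq d - S₁) + 2 * s * (ctrlCross d - S₂) + s ^ 2 * (ctrlSqInit d - S₃)) := by
    rw [hV, hye, hYd]
    ring
  have hb := weights_bound (by linarith) (by positivity) hx hy hl (sub_nonneg.2 q1)
    (sub_nonneg.2 q2) (sub_nonneg.2 q3) hdom hdomw hUK hV'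
  have hi := fun i : Fin t => le_contrastVar d v i
    (pairEffect i ((t - 1) * t * (m + 1) / x) ((t - 1) * t * (m + 1) / x / t - (m + 1) / y))
    (pairEffect i (l * ((t - 1) * t * (m + 1) / x))
      (l * ((t - 1) * t * (m + 1) / x) / t - s * ((m + 1) / y)))
  refine le_trans ?_ ((ofReal_sum_le _ _).trans (Finset.sum_le_sum fun i _ => hi i))
  refine ENNReal.ofReal_le_ofReal ?_
  rw [← Finset.mul_sum]
  refine mul_le_mul_of_nonneg_left ?_ v.2
  simp only [effect_weights, pairEffect_sub, center_dotProduct_center m.succ_ne_zero hn,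
    Finset.sum_sub_distrib, hw, Finset.sum_const, Finset.card_univ, Fintype.card_fin, nsmul_eq_mul]
  push_cast
  exact hb

end Crossover

namespace Crossover

variable {m n t : ℕ}

/-! ### Totally balanced designs attain the bound -/

/-- For integers x, (x - q)(x - q - 1) ≥ 0, with equality exactly at q and q + 1; with equal sums,
this compares the sums of squares. -/
theorem sum_sq_le_of_near_constant {ι : Type*} {s : Finset ι} {f g : ι → ℕ} {q : ℕ}
    (hf : ∀ i ∈ s, f i = q ∨ f i = q + 1) (hfg : ∑ i ∈ s, f i = ∑ i ∈ s, g i) :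
    ∑ i ∈ s, f i ^ 2 ≤ ∑ i ∈ s, g i ^ 2 := by
  have hfg' : ∑ i ∈ s, (f i : ℤ) = ∑ i ∈ s, (g i : ℤ) := by exact_mod_cast hfg
  have hf0 : ∑ i ∈ s, ((f i : ℤ) - q) * (f i - q - 1) = 0 := by
    refine Finset.sum_eq_zero fun i hi => ?_
    rcases hf i hi with h | h <;> rw [h] <;> push_cast <;> ring
  have hg0 : 0 ≤ ∑ i ∈ s, ((g i : ℤ) - q) * (g i - q - 1) := by
    refine Finset.sum_nonneg fun i _ => ?_
    rcases le_or_gt (g i : ℤ) q with h | h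
    · exact mul_nonneg_of_nonpos_of_nonpos (by linarith) (by linarith)
    · exact mul_nonneg (by linarith) (by linarith)
  have e : ∀ h : ι → ℕ, ∑ i ∈ s, ((h i : ℤ) - q) * (h i - q - 1) =
      ∑ i ∈ s, (h i : ℤ) ^ 2 - (2 * q + 1) * ∑ i ∈ s, (h i : ℤ) + ∑ _i ∈ s, (q : ℤ) * (q + 1) :=
    fun h => by
      rw [Finset.mul_sum, ← Finset.sum_sub_distrib, ← Finset.sum_add_distrib]
      exact Finset.sum_congr rfl fun i _ => by ring
  rw [e] at hf0 hg0
  rw [hfg'] at hf0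
  have : ∑ i ∈ s, (f i : ℤ) ^ 2 ≤ ∑ i ∈ s, (g i : ℤ) ^ 2 := by linarith
  exact_mod_cast this

theorem minOver_eq {p r : ℕ} {d : Design p n t} (hd : d ∈ Lam t n p) (hr : replication d 0 = r)
    {f : Design p n t → ℕ} (h : ∀ d' ∈ Lam t n p, replication d' 0 = r → f d ≤ f d') :
    minOver t n p r f = f d := by
  obtain ⟨d', hd', hr', e⟩ := exists_minOver_eq hd hr f
  exact le_antisymm (minOver_le hd hr f) (e ▸ h d' hd' hr')

/-! ### A totally balanced design attains the three minima -/

namespace IsTotallyBalanced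

variable {d : Design (m + 1) n t} {r : ℕ}

theorem mem_lam {p : ℕ} {d : Design p n t} (hd : IsTotallyBalanced d) : d ∈ Lam t n p :=
  ⟨hd.proportional.control, hd.carryover.no_self⟩

theorem ctrlSq_le (hd : IsTotallyBalanced d) {d' : Design (m + 1) n t}
    (hr : replication d' 0 = replication d 0) : ctrlSq d ≤ ctrlSq d' :=
  sum_sq_le_of_near_constant (fun u _ => hd.block.control u)
    (by rw [sum_unitCount, sum_unitCount, hr])

theorem ctrlSqInit_le (hd : IsTotallyBalanced d) {d' : Design (m + 1) n t}
    (hd' : d' ∈ Lam t n (m + 1)) (hr : replication d' 0 = replication d 0) :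
    ctrlSqInit d ≤ ctrlSqInit d' := by
  refine sum_sq_le_of_near_constant (fun u _ => hd.block_carryover.control u) ?_
  have h := (isCompeting_of_mem hd.mem_lam rfl).sum_unitCountInit_eq
  have h' := (isCompeting_of_mem hd' hr).sum_unitCountInit_eq
  exact_mod_cast h.trans h'.symm

theorem minSq_eq (hd : IsTotallyBalanced d) (hr : replication d 0 = r) :
    minSq t n (m + 1) r = ctrlSq d :=
  minOver_eq hd.mem_lam hr (f := ctrlSq) fun _ _ hr' => hd.ctrlSq_le (hr'.trans hr.symm)

theorem minSqInit_eq (hd : IsTotallyBalanced d) (hr : replication d 0 = r) :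
    minSqInit t n (m + 1) r = ctrlSqInit d :=
  minOver_eq hd.mem_lam hr (f := ctrlSqInit) fun _ hd' hr' =>
    hd.ctrlSqInit_le hd' (hr'.trans hr.symm)

theorem minCross_eq (hd : IsTotallyBalanced d) (hr : replication d 0 = r) :
    minCross t n (m + 1) r = ctrlCross d := by
  refine minOver_eq hd.mem_lam hr (f := ctrlCross) fun d' hd' hr' => ?_
  have h := (isCompeting_of_mem hd.mem_lam hr).two_mul_ctrlCross
  have h' := (isCompeting_of_mem hd' hr').two_mul_ctrlCross
  have h1 : (ctrlSq d : ℝ) ≤ ctrlSq d' := by exact_mod_cast hd.ctrlSq_le (hr'.trans hr.symm)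
  have h2 : (ctrlSqInit d : ℝ) ≤ ctrlSqInit d' := by
    exact_mod_cast hd.ctrlSqInit_le hd' (hr'.trans hr.symm)
  have : (ctrlCross d : ℝ) ≤ ctrlCross d' := by linarith
  exact_mod_cast this

end IsTotallyBalanced

theorem sum_mul_eq_card {ι : Type*} [Fintype ι] {f g : ι → ℕ} {P : ι → Prop} [DecidablePred P]
    (hf : ∀ u, f u ≤ 1) (hg : ∀ u, g u ≤ 1) (hP : ∀ u, P u ↔ f u = 1 ∧ g u = 1) :
    ∑ u, (f u : ℝ) * g u = (Finset.univ.filter P).card := by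
  rw [Finset.card_filter, Nat.cast_sum]
  refine Finset.sum_congr rfl fun u _ => ?_
  have h1 := hf u
  have h2 := hg u
  have h3 := hP u
  by_cases h : P u
  · rw [if_pos h, (h3.1 h).1, (h3.1 h).2]; norm_num
  · rw [if_neg h]
    have : f u = 0 ∨ g u = 0 := by
      by_contra! hne
      exact h (h3.2 ⟨by omega, by omega⟩)
    rcases this with h0 | h0 <;> rw [h0] <;> simp

theorem sum_mul_self_eq {ι : Type*} {s : Finset ι} {f : ι → ℕ}
    (hf : ∀ u, f u ≤ 1) : ∑ u ∈ s, (f u : ℝ) * f u = ((∑ u ∈ s, f u : ℕ) : ℝ) := by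
  rw [Nat.cast_sum]
  refine Finset.sum_congr rfl fun u _ => ?_
  have : f u = 0 ∨ f u = 1 := by have := hf u; omega
  rcases this with h | h <;> rw [h] <;> simp

/-! ### Complete symmetry of the centered Gram matrices on the test treatments -/

namespace IsTotallyBalanced

variable {d : Design (m + 1) n t} {e : ℝ}

theorem unitCountInit_le_one (hd : IsTotallyBalanced d) (i : Fin t) (u : Fin n) :
    unitCountInit d i.succ u ≤ 1 := hd.block_carryover.binary i u

/-- Test treatments are binary in units, so products of unit counts count common units, and constant
period counts make the period and grand-total terms cancel. -/
theorem gram_direct (hd : IsTotallyBalanced d) (hn : n ≠ 0)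
    (he : ∀ (i : Fin t) k, (periodCount d i.succ k : ℝ) = e) :
    ∃ β : ℝ, ∀ i j : Fin t,
      center (m + 1) n (directInc d i.succ) ⬝ᵥ directInc d j.succ =
        if i = j then m * e else β := by
  have hn' : (n : ℝ) ≠ 0 := by exact_mod_cast hn
  obtain ⟨q, hq⟩ := hd.block.pair
  refine ⟨-(q : ℝ) / (m + 1), fun i j => ?_⟩
  rw [center_directInc_directInc, replication_of_periodCount (he i),
    replication_of_periodCount (he j)]
  simp only [he, Fin.succ_inj, Finset.sum_const, Finset.card_univ, Fintype.card_fin, nsmul_eq_mul]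
  rcases eq_or_ne i j with rfl | h
  · rw [if_pos rfl, if_pos rfl, sum_mul_self_eq (hd.block.binary i), sum_unitCount,
      replication_of_periodCount (he i)]
    push_cast
    field_simp
    ring
  · rw [if_neg h, if_neg h, sum_mul_eq_card (hd.block.binary i) (hd.block.binary j)
      (P := fun u => 1 ≤ unitCount d i.succ u ∧ 1 ≤ unitCount d j.succ u), hq i j h]
    · push_cast
      field_simp
      ring
    · intro u
      have := hd.block.binary i u
      have := hd.block.binary j u
      omega

theorem gram_mixed (hd : IsTotallyBalanced d) (hn : n ≠ 0)
    (he : ∀ (i : Fin t) k, (periodCount d i.succ k : ℝ) = e) :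
    ∃ β : ℝ, ∀ i j : Fin t,
      center (m + 1) n (directInc d i.succ) ⬝ᵥ carryInc d j.succ =
        if i = j then - (m * e / (m + 1)) else β := by
  have hn' : (n : ℝ) ≠ 0 := by exact_mod_cast hn
  obtain ⟨q, hq⟩ := hd.mixed_test
  obtain ⟨q', hq'⟩ := hd.carryover.test_test
  refine ⟨q' - (q : ℝ) / (m + 1), fun i j => ?_⟩
  rw [center_directInc_carryInc, replication_of_periodCount (he i),
    replicationInit_of_periodCount (he j)]
  simp only [he, Finset.sum_const, Finset.card_univ, Fintype.card_fin, nsmul_eq_mul]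
  rcases eq_or_ne i j with rfl | h
  · rw [if_pos rfl, hd.carryover.no_self]
    have e1 : ∑ u, (unitCount d i.succ u : ℝ) * unitCountInit d i.succ u = m * e := by
      rw [← replicationInit_of_periodCount (he i), ← sum_unitCountInit, Nat.cast_sum]
      refine Finset.sum_congr rfl fun u _ => ?_
      have h1 := hd.block.binary i u
      have h2 := unitCountInit_le d i.succ u
      have : unitCountInit d i.succ u = 0 ∨
          (unitCountInit d i.succ u = 1 ∧ unitCount d i.succ u = 1) := by omega
      rcases this with h | ⟨h, h'⟩
      · simp [h]
      · simp [h, h']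
    rw [e1]
    push_cast
    field_simp
    ring
  · rw [if_neg h, hq' i j h, sum_mul_eq_card (hd.block.binary i) (hd.unitCountInit_le_one j)
      (P := fun u => unitCountInit d j.succ u = 1 ∧ unitCount d i.succ u = 1)
      (fun u => and_comm), hq i j h]
    field_simp
    ring

theorem gram_carryover (hd : IsTotallyBalanced d) (hn : n ≠ 0)
    (he : ∀ (i : Fin t) k, (periodCount d i.succ k : ℝ) = e) :
    ∃ β : ℝ, ∀ i j : Fin t,
      center (m + 1) n (carryInc d i.succ) ⬝ᵥ carryInc d j.succ =
        if i = j then m * e - m * e / (m + 1) - m * e ^ 2 / (n * (m + 1)) else β := by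
  have hn' : (n : ℝ) ≠ 0 := by exact_mod_cast hn
  obtain ⟨q, hq⟩ := hd.block_carryover.pair
  refine ⟨-(q : ℝ) / (m + 1) - m * e ^ 2 / (n * (m + 1)), fun i j => ?_⟩
  rw [center_carryInc_carryInc, replicationInit_of_periodCount (he i),
    replicationInit_of_periodCount (he j)]
  simp only [he, Fin.succ_inj, Finset.sum_const, Finset.card_univ, Fintype.card_fin, nsmul_eq_mul]
  rcases eq_or_ne i j with rfl | h
  · rw [if_pos rfl, if_pos rfl, sum_mul_self_eq (hd.unitCountInit_le_one i), sum_unitCountInit,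
      replicationInit_of_periodCount (he i)]
    field_simp
    ring
  · rw [if_neg h, if_neg h, sum_mul_eq_card (hd.unitCountInit_le_one i)
      (hd.unitCountInit_le_one j)
      (P := fun u => 1 ≤ unitCountInit d i.succ u ∧ 1 ≤ unitCountInit d j.succ u)]
    · have := hq i j h
      change (Finset.univ.filter fun u =>
        1 ≤ unitCountInit d i.succ u ∧ 1 ≤ unitCountInit d j.succ u).card = q at this
      rw [this]
      field_simp
      ring
    · intro u
      have := hd.unitCountInit_le_one i u
      have := hd.unitCountInit_le_one j u
      omega

end IsTotallyBalanced

/-- A Gram matrix with zero row and column sums and a completely symmetric block is determined by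
that block. -/
theorem gram_border {p : ℕ} {x y : Fin (t + 1) → Fin p × Fin n → ℝ}
    (hx : center p n (x 0) + ∑ i : Fin t, center p n (x i.succ) = 0)
    (hy : center p n (y 0) + ∑ i : Fin t, center p n (y i.succ) = 0) {α β : ℝ}
    (h : ∀ i j : Fin t, center p n (x i.succ) ⬝ᵥ y j.succ = if i = j then α else β) :
    (∀ i : Fin t, center p n (x i.succ) ⬝ᵥ y 0 = -(α + (t - 1) * β)) ∧
      (∀ j : Fin t, center p n (x 0) ⬝ᵥ y j.succ = -(α + (t - 1) * β)) ∧
      center p n (x 0) ⬝ᵥ y 0 = t * (α + (t - 1) * β) := by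
  have hrow : ∀ w, center p n (x 0) ⬝ᵥ w = -∑ i : Fin t, center p n (x i.succ) ⬝ᵥ w := fun w => by
    rw [← sum_dotProduct, ← neg_dotProduct, eq_neg_of_add_eq_zero_left hx]
  have hcol : ∀ w, center p n w ⬝ᵥ y 0 = -∑ i : Fin t, center p n w ⬝ᵥ y i.succ := fun w => by
    simp only [center_dotProduct_comm w]
    rw [← sum_dotProduct, ← neg_dotProduct, eq_neg_of_add_eq_zero_left hy]
  have hs : ∀ i : Fin t, ∑ j : Fin t, (if i = j then α else β) = α + (t - 1) * β := fun i => by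
    have e : ∀ j : Fin t, (if i = j then α else β) = (if i = j then α - β else 0) + β := fun j => by
      split_ifs <;> ring
    simp only [e, Finset.sum_add_distrib, Finset.sum_ite_eq, Finset.mem_univ, if_true,
      Finset.sum_const, Finset.card_univ, Fintype.card_fin, nsmul_eq_mul]
    ring
  have h1 : ∀ i : Fin t, center p n (x i.succ) ⬝ᵥ y 0 = -(α + (t - 1) * β) := fun i => by
    rw [hcol]
    simp only [h, hs]
  refine ⟨h1, fun j => ?_, ?_⟩
  · rw [hrow]
    simp only [h, eq_comm (b := j), hs]
  · rw [hrow]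
    simp only [h1, Finset.sum_const, Finset.card_univ, Fintype.card_fin, nsmul_eq_mul]
    ring

/-- In a totally balanced design every contrast has the variance given by the bound. -/
theorem contrastVar_le_of_isTotallyBalanced (hm : 2 ≤ m) (hmt : m ≤ t) {d : Design (m + 1) n t}
    (hd : IsTotallyBalanced d) {r : ℕ} (hr : replication d 0 = r) (hr0 : 0 < r) (v : ℝ≥0)
    (i : Fin t) :
    contrastVar d v i ≤ ENNReal.ofReal (v * (lowerBound t n (m + 1) r / t)) := by
  obtain ⟨X, Y, hP⟩ := boundParts hm hmt hd.mem_lam hr hr0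
  have hcomp := isCompeting_of_mem hd.mem_lam hr
  have hc : 0 < (r : ℝ) / (m + 1) := by positivity
  have ht : t ≠ 0 := by omega
  have ht' : (t : ℝ) ≠ 0 := by exact_mod_cast ht
  have he : ∀ (i : Fin t) k, (periodCount d i.succ k : ℝ) = (n - (r : ℝ) / (m + 1)) / t :=
    fun i k => by
      rw [hd.proportional.test, hr]
      push_cast
      field_simp
  rw [hd.minSq_eq hr, hd.minCross_eq hr, hd.minSqInit_eq hr] at hP
  rw [lowerBound]
  generalize x₁ t n (m + 1) r = x at *
  generalize y₁ t n (m + 1) r = y at *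
  generalize (r : ℝ) / (m + 1) = c at *
  have h2c := hcomp.two_mul_le (by omega)
  have hn' : (0 : ℝ) < n := by linarith
  have hn : n ≠ 0 := by
    rintro rfl
    simp at hn'
  obtain ⟨hXd, hYd, hX, hY, hx, hy, -, hxe, hye, -, -⟩ := hP
  obtain ⟨β₁, g1⟩ := hd.gram_direct hn he
  obtain ⟨β₂, g2⟩ := hd.gram_mixed hn he
  obtain ⟨β₃, g3⟩ := hd.gram_carryover hn he
  have sT := sum_center_directInc hn d
  have sF := sum_center_carryInc hn d
  obtain ⟨r1, r1', k1⟩ := gram_border sT sT g1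
  obtain ⟨r2, r2', k2⟩ := gram_border sT sF g2
  obtain ⟨r3, r3', k3⟩ := gram_border sF sF g3
  -- The control diagonal entries are now known in two ways, from the borders and from the control
  -- counts. Equating them determines the off-diagonal `β₁`, `β₂`, `β₃`.
  have k1' := k1
  have k2' := k2
  have k3' := k3
  rw [center_directInc_zero hn hcomp.period] at k1'
  rw [center_directInc_carryInc_zero hn hcomp.period (hcomp.no_self 0)] at k2'
  rw [center_carryInc_zero hn hcomp.period] at k3'
  set e := ((n : ℝ) - c) / t with hedef
  have hte : t * e = n - c := by rw [hedef]; field_simp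
  generalize (ctrlSq d : ℝ) = S₁ at *
  generalize (ctrlCross d : ℝ) = S₂ at *
  generalize (ctrlSqInit d : ℝ) = S₃ at *
  clear_value e
  generalize hα₃ : m * e - m * e / (m + 1) - m * e ^ 2 / (n * (m + 1)) = α₃ at *
  have hM : (0 : ℝ) < m + 1 := by positivity
  set a := t * m * (n - c) - S₂ with hadef
  set l := a / X with hl
  set s := S₂ / Y with hs
  -- A completely symmetric block has two eigenvalues: α + (t-1)β on constants (`q1`, `q2`, `q3`)
  -- gives the ingredients of y, and α - β on contrasts (`p1`, `p2`, `p3`) those of x.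
  have q1 : t * (m + 1) * (m * e + (t - 1) * β₁) = (m + 1) ^ 2 * c - S₁ := by
    field_simp at k1'
    linarith
  have q2 : t * (m + 1) * (-(m * e / (m + 1)) + (t - 1) * β₂) = - S₂ := by
    field_simp at k2' ⊢
    linarith
  have q3 : t * (m + 1) * (α₃ + (t - 1) * β₃) = Y := by
    rw [mul_right_comm, ← k3', hYd]
    field_simp
    ring
  have p1 : t * (m + 1) * (t - 1) * (m * e - β₁) =
      t * m * (m + 1) * (n - c) - ((m + 1) ^ 2 * c - S₁) := by
    rw [← q1, ← hte]; ring
  have p2 : t * (m + 1) * (t - 1) * (-(m * e / (m + 1)) - β₂) = - a := by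
    have : t * (m + 1) * (t - 1) * (-(m * e / (m + 1)) - β₂) =
        t * t * (m + 1) * (-(m * e / (m + 1)))
          - t * (m + 1) * (-(m * e / (m + 1)) + (t - 1) * β₂) := by ring
    rw [this, q2, hadef, ← hte]
    field_simp
    ring
  have p3 : t * (m + 1) * (t - 1) * (α₃ - β₃) = X := by
    have : t * (m + 1) * (t - 1) * (α₃ - β₃) = t * t * (m + 1) * α₃
        - t * (m + 1) * (α₃ + (t - 1) * β₃) := by ring
    rw [this, q3, hYd, hXd, ← hα₃]
    have hc' : c = n - t * e := by linarith
    rw [hc']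
    field_simp
    ring
  have lX : l * X = a := by rw [hl]; field_simp
  have sY : s * Y = S₂ := by rw [hs]; field_simp
  have ht1 : (t : ℝ) - 1 ≠ 0 := by
    have : (2 : ℝ) ≤ t := by exact_mod_cast hm.trans hmt
    linarith
  have hne : (t : ℝ) * (m + 1) * (t - 1) ≠ 0 := mul_ne_zero (mul_ne_zero ht' hM.ne') ht1
  -- The coefficient l annihilates the carryover equations on contrasts, and s does so on constants
  -- (`w2`). The direct equations then reduce to x and y (`z1`, `w1`).
  have z2 : -(m * e / (m + 1)) - β₂ + l * (α₃ - β₃) = 0 := by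
    have : t * (m + 1) * (t - 1) * (-(m * e / (m + 1)) - β₂ + l * (α₃ - β₃)) = 0 := by
      rw [mul_add, p2, mul_left_comm, p3, lX]; ring
    exact (mul_eq_zero.1 this).resolve_left hne
  have z1 : t * (m + 1) * (t - 1) * (m * e - β₁ + l * (-(m * e / (m + 1)) - β₂)) = x := by
    rw [mul_add, p1, mul_left_comm, p2, hxe]
    linear_combination (-l) * lX
  have w2 : (-(m * e / (m + 1)) + (t - 1) * β₂) + s * (α₃ + (t - 1) * β₃) = 0 := by
    have : t * (m + 1) * ((-(m * e / (m + 1)) + (t - 1) * β₂) + s * (α₃ + (t - 1) * β₃)) = 0 := by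
      rw [mul_add, q2, mul_left_comm, q3, sY]; ring
    exact (mul_eq_zero.1 this).resolve_left (mul_ne_zero ht' hM.ne')
  have w1 : t * (m + 1) * ((m * e + (t - 1) * β₁) + s * (-(m * e / (m + 1)) + (t - 1) * β₂)) =
      y := by
    rw [mul_add, q1, mul_left_comm, q2, hye]
    linear_combination (-s) * sY
  generalize -(m * e / (m + 1)) = α₂ at *
  generalize m * e = α₁ at *
  have hz1 : (t - 1) * t * (m + 1) / x * (α₁ - β₁ + l * (α₂ - β₂)) = 1 := by
    field_simp
    linear_combination z1
  have hw1 : (m + 1) / y * (α₁ + (t - 1) * β₁ + s * (α₂ + (t - 1) * β₂)) = 1 / t := by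
    field_simp
    linear_combination w1
  have e2 : (t : ℝ) * (t - 1) ^ 2 * ((m + 1 : ℕ) : ℝ) / x + t * ((m + 1 : ℕ) : ℝ) / y =
      t * ((t - 1) * t * (m + 1) / x - ((t - 1) * t * (m + 1) / x / t - (m + 1) / y)) := by
    push_cast
    field_simp
    ring
  rw [e2, mul_div_cancel_left₀ _ ht']
  generalize (t - 1) * t * (m + 1) / x = A at *
  generalize ((m : ℝ) + 1) / y = B at *
  rw [← pairEffect_sub i A (A / t - B)]
  refine contrastVar_le m.succ_ne_zero hn d v i _
    (pairEffect i (l * A) (l * A / t - s * B)) ?_ ?_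
  · intro j
    rw [effect_weights]
    simp only [mixInc, map_add, map_sub, map_smul, add_dotProduct, smul_dotProduct,
      sub_dotProduct, smul_eq_mul, center_dotProduct_comm (carryInc d _) (directInc d _)]
    cases j using Fin.cases with
    | zero =>
      rw [r1, r2', k1, k2, if_neg (Fin.succ_ne_zero i).symm, if_pos rfl]
      field_simp
      field_simp at hw1
      linear_combination -hw1
    | succ j =>
      rw [g1, g2, r1', r2, if_neg (Fin.succ_ne_zero j)]
      simp only [Fin.succ_inj]
      rcases eq_or_ne i j with rfl | hij
      · simp only [if_true]
        field_simp
        field_simp at hw1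
        linear_combination (t - 1) * hz1 + hw1
      · rw [if_neg hij, if_neg hij.symm, if_neg hij.symm]
        field_simp
        field_simp at hw1
        linear_combination -hz1 + hw1
  · intro j
    rw [effect_weights]
    simp only [mixInc, map_add, map_sub, map_smul, add_dotProduct, smul_dotProduct,
      sub_dotProduct, smul_eq_mul]
    cases j using Fin.cases with
    | zero =>
      rw [r2, r3, k2, k3]
      field_simp
      linear_combination (-(B * t)) * w2
    | succ j =>
      rw [g2, g3, r2', r3']
      rcases eq_or_ne i j with rfl | hij
      · simp only [if_true]
        field_simp
        linear_combination A * (t - 1) * z2 + B * t * w2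
      · rw [if_neg hij, if_neg hij]
        field_simp
        linear_combination (-A) * z2 + B * t * w2

end Crossover

/-! ### Both optimality criteria from the bound on the sum -/

theorem theorem1 (t n p : ℕ) (hp : 3 ≤ p) (hpt : p ≤ t + 1) (v : ℝ≥0) (hv : 0 < v)
    (d : Crossover.Design p n t) (hd : Crossover.IsTotallyBalanced d)
    (hr : Crossover.replication d 0 ∈ Crossover.admissible t n p)
    (hmin : IsMinOn (Crossover.lowerBound t n p) (Crossover.admissible t n p)
      (Crossover.replication d 0)) :
    Crossover.IsAOptimal v (Crossover.Lam t n p) d ∧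
      Crossover.IsMVOptimal v (Crossover.Lam t n p) d := by
  open Crossover in
  obtain ⟨m, rfl⟩ : ∃ m, p = m + 1 := ⟨p - 1, by omega⟩
  have hm : 2 ≤ m := by omega
  have hmt : m ≤ t := by omega
  have ht : t ≠ 0 := by omega
  have ht' : (0 : ℝ) < t := by exact_mod_cast Nat.pos_of_ne_zero ht
  have : Nonempty (Fin t) := ⟨⟨0, Nat.pos_of_ne_zero ht⟩⟩
  set L := lowerBound t n (m + 1) (replication d 0) with hL
  have hup : ∀ i, contrastVar d v i ≤ ENNReal.ofReal (v * (L / t)) :=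
    contrastVar_le_of_isTotallyBalanced hm hmt hd rfl hr.1 v
  have hdiv : ENNReal.ofReal (v * (L / t)) = ENNReal.ofReal (v * L) / t := by
    rw [← mul_div_assoc, ENNReal.ofReal_div_of_pos ht', ENNReal.ofReal_natCast]
  have hsum : ∑ i, contrastVar d v i ≤ ENNReal.ofReal (v * L) := by
    refine (Finset.sum_le_sum fun i _ => hup i).trans ?_
    rw [Finset.sum_const, Finset.card_univ, Fintype.card_fin, nsmul_eq_mul, hdiv]
    exact ENNReal.mul_div_le
  have hlow : ∀ d' ∈ Lam t n (m + 1), ENNReal.ofReal (v * L) ≤ ∑ i, contrastVar d' v i := by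
    intro d' hd'
    -- A competitor without control lies outside the range of minimization, but all its variances
    -- are infinite.
    rcases Nat.eq_zero_or_pos (replication d' 0) with h0 | h0
    · have hne : ∀ k u, d' k u ≠ 0 := fun k u h => by
        rw [replication, Finset.card_eq_zero, Finset.filter_eq_empty_iff] at h0
        exact h0 (Finset.mem_univ (k, u)) h
      rw [Finset.sum_congr rfl fun i _ => contrastVar_eq_top d' v i hne]
      simp [ht]
    · refine le_trans (ENNReal.ofReal_le_ofReal (mul_le_mul_of_nonneg_left ?_ v.2))
        (le_sum_contrastVar hm hmt hd' rfl h0 v)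
      exact isMinOn_iff.1 hmin _ ⟨h0, d', hd', rfl⟩
  refine ⟨⟨hd.mem_lam, hsum.trans_lt ENNReal.ofReal_lt_top, fun d' hd' => hsum.trans (hlow d' hd')⟩,
    hd.mem_lam, (iSup_le hup).trans_lt ENNReal.ofReal_lt_top, fun d' hd' => ?_⟩
  refine (iSup_le hup).trans ?_
  rw [hdiv]
  -- The largest variance is at least the average one.
  refine ENNReal.div_le_of_le_mul' ((hlow d' hd').trans ?_)
  refine (Finset.sum_le_sum fun i _ => le_iSup (contrastVar d' v) i).trans ?_
  rw [Finset.sum_const, Finset.card_univ, Fintype.card_fin, nsmul_eq_mul]
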